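/- Let $\mathbb H^3$ be hyperbolic $3$-space (curvature $-1$) and $\mathrm{Isom}^+(\mathbb H^3)=SO^+(3,1)$ its group of orientation-preserving isometries. Let $M=\mathbb H^3/\Gamma_M$ and $N=\mathbb H^3/\Gamma_N$ be (connected, complete) orientable hyperbolic $3$-manifolds, where $\Gamma_M\cong\pi_1(M)$ and $\Gamma_N\cong\pi_1(N)$ are subgroups of $\mathrm{Isom}^+(\mathbb H^3)$ acting freely and properly discontinuously on $\mathbb H^3$; no finiteness of volume or of generation is assumed. Suppose that both are nonelementary, that is, neither $\Gamma_M$ nor $\Gamma_N$ has a finite orbit in $\mathbb H^3\cup\partial\mathbb H^3$. For an isometry $\gamma$ of $\mathbb H^3$ let $\ell(\gamma)=\inf_{x\in\mathbb H^3}d(x,\gamma x)$ be its translation length (for a deck transformation $\gamma$, the length of the closed geodesic in the corresponding free homotopy class, and $0$ if there is none). If $M$ and $N$ have the same marked length spectrum, i.e. there is a group isomorphism $\varphi:\Gamma_M\to\Gamma_N$ with $\ell(\varphi(\gamma))=\ell(\gamma)$ for all $\gamma\in\Gamma_M$, then $M$ and $N$ are isometric. -/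

import Mathlib

/-! # Orientable hyperbolic 3-manifolds as quotients of hyperbolic 3-space -/

namespace Hyp3

noncomputable section

/-- The real vector space underlying Minkowski space of signature (3,1). -/
abbrev Mink : Type := Fin 4 → ℝ

/-- The Lorentz form: the last coordinate is the time coordinate. -/
def form (x y : Mink) : ℝ := x 0 * y 0 + x 1 * y 1 + x 2 * y 2 - x 3 * y 3

theorem form_comm (x y : Mink) : form x y = form y x := by
  simp only [form]; ring

theorem form_neg_neg (x y : Mink) : form (-x) (-y) = form x y := by
  simp only [form, Pi.neg_apply]; ring

/-- Hyperbolic 3-space: the upper sheet of the two-sheeted hyperboloid. -/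
def H3 : Type := {x : Mink // form x x = -1 ∧ 0 < x 3}

namespace H3

/-- A vector orthogonal to a point of the hyperboloid is spacelike or zero. -/
theorem form_self_nonneg_of_orthogonal {y u : Mink} (hy : form y y = -1)
    (h : form u y = 0) : 0 ≤ form u u ∧ (form u u = 0 → u = 0) := by
  simp only [form] at hy h ⊢
  have hyp : 1 ≤ y 3 * y 3 := by
        nlinarith [mul_self_nonneg (y 0), mul_self_nonneg (y 1),
    mul_self_nonneg (y 2)]
  have e : u 3 * y 3 = u 0 * y 0 + u 1 * y 1 + u 2 * y 2 := by linarith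
  have cs : (u 3 * y 3) ^ 2 ≤
      (u 0 * u 0 + u 1 * u 1 + u 2 * u 2) * (y 0 * y 0 + y 1 * y 1 + y 2 * y 2) := by
    rw [e]
    nlinarith [sq_nonneg (u 0 * y 1 - u 1 * y 0), sq_nonneg (u 0 * y 2 - u 2 * y 0),
      sq_nonneg (u 1 * y 2 - u 2 * y 1)]
  have hs : y 0 * y 0 + y 1 * y 1 + y 2 * y 2 = y 3 * y 3 - 1 := by linarith
  rw [hs] at cs
  set U := u 0 * u 0 + u 1 * u 1 + u 2 * u 2 with hU
  have hU0 : 0 ≤ U := by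
    linarith [mul_self_nonneg (u 0), mul_self_nonneg (u 1), mul_self_nonneg (u 2)]
  have key : U ≤ (U - u 3 * u 3) * (y 3 * y 3) := by nlinarith
  have hpos : 0 ≤ U - u 3 * u 3 := by
    by_contra hneg
    push Not at hneg
    nlinarith
  refine ⟨hpos, fun h0 => ?_⟩
  rw [h0, zero_mul] at key
  have hUz : U = 0 := le_antisymm key hU0
  have h0' : u 0 = 0 := by
        nlinarith [mul_self_nonneg (u 0), mul_self_nonneg (u 1),
    mul_self_nonneg (u 2)]
  have h1' : u 1 = 0 := by
        nlinarith [mul_self_nonneg (u 0), mul_self_nonneg (u 1),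
    mul_self_nonneg (u 2)]
  have h2' : u 2 = 0 := by
        nlinarith [mul_self_nonneg (u 0), mul_self_nonneg (u 1),
    mul_self_nonneg (u 2)]
  have h3' : u 3 = 0 := by
        nlinarith [mul_self_nonneg (u 3)]
  ext i
  fin_cases i <;> simp [h0', h1', h2', h3']

theorem one_le_neg_form (x y : H3) : 1 ≤ -form x.1 y.1 := by
  obtain ⟨x, hx, hx3⟩ := x
  obtain ⟨y, hy, hy3⟩ := y
  simp only
  have hxy : 0 < -form x y := by
    simp only [form] at hx hy ⊢
    have cs : (x 0 * y 0 + x 1 * y 1 + x 2 * y 2) ^ 2 ≤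
        (x 0 * x 0 + x 1 * x 1 + x 2 * x 2) * (y 0 * y 0 + y 1 * y 1 + y 2 * y 2) := by
      nlinarith [sq_nonneg (x 0 * y 1 - x 1 * y 0), sq_nonneg (x 0 * y 2 - x 2 * y 0),
        sq_nonneg (x 1 * y 2 - x 2 * y 1)]
    have hsx : x 0 * x 0 + x 1 * x 1 + x 2 * x 2 = x 3 * x 3 - 1 := by linarith
    have hsy : y 0 * y 0 + y 1 * y 1 + y 2 * y 2 = y 3 * y 3 - 1 := by linarith
    rw [hsx, hsy] at cs
    have : x 0 * y 0 + x 1 * y 1 + x 2 * y 2 < x 3 * y 3 := by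
      apply lt_of_pow_lt_pow_left₀ 2 (by positivity)
      have h1 : 1 ≤ x 3 * x 3 := by
        nlinarith [mul_self_nonneg (x 0), mul_self_nonneg (x 1),
        mul_self_nonneg (x 2)]
      have h2 : 1 ≤ y 3 * y 3 := by
        nlinarith [mul_self_nonneg (y 0), mul_self_nonneg (y 1),
        mul_self_nonneg (y 2)]
      nlinarith
    linarith
  have h := (form_self_nonneg_of_orthogonal (u := x + form x y • y) hy (by
    simp only [form, Pi.add_apply, Pi.smul_apply, smul_eq_mul] at hy ⊢
    linear_combination (x 0 * y 0 + x 1 * y 1 + x 2 * y 2 - x 3 * y 3) * hy)).1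
  have e : form (x + form x y • y) (x + form x y • y) = form x y ^ 2 - 1 := by
    simp only [form, Pi.add_apply, Pi.smul_apply, smul_eq_mul] at hx hy ⊢
    linear_combination hx + (x 0 * y 0 + x 1 * y 1 + x 2 * y 2 - x 3 * y 3) ^ 2 * hy
  rw [e] at h
  nlinarith

/-- The hyperbolic distance (curvature -1): `cosh (dist x y) = -⟨x, y⟩`. -/
instance : Dist H3 := ⟨fun x y => Real.arcosh (-form x.1 y.1)⟩

theorem dist_def (x y : H3) : dist x y = Real.arcosh (-form x.1 y.1) := rfl

protected theorem dist_self (x : H3) : dist x x = 0 := by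
  rw [dist_def, x.2.1, neg_neg, Real.arcosh_eq_zero_iff le_rfl]

protected theorem dist_comm (x y : H3) : dist x y = dist y x := by
  rw [dist_def, dist_def, form_comm]

protected theorem dist_triangle (x y z : H3) : dist x z ≤ dist x y + dist y z := by
  have ha := one_le_neg_form x y
  have hb := one_le_neg_form y z
  have hc := one_le_neg_form x z
  rw [dist_def, dist_def, dist_def]
  have hnn := add_nonneg (Real.arcosh_nonneg ha) (Real.arcosh_nonneg hb)
  rw [← Real.arcosh_cosh hnn]
  rw [Real.arcosh_le_arcosh (by linarith) (Real.cosh_pos _), Real.cosh_add,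
    Real.cosh_arcosh ha, Real.cosh_arcosh hb, Real.sinh_arcosh ha, Real.sinh_arcosh hb]
  obtain ⟨x, hx, hx3⟩ := x
  obtain ⟨y, hy, hy3⟩ := y
  obtain ⟨z, hz, hz3⟩ := z
  simp only at ha hb hc ⊢
  set a := form x y with haa
  set b := form y z with hbb
  set c := form x z with hcc
  have key : ∀ t : ℝ, 0 ≤ (b ^ 2 - 1) * (t * t) + (2 * (c + a * b)) * t + (a ^ 2 - 1) := by
    intro t
    have h := (form_self_nonneg_of_orthogonal (u := (x + a • y) + t • (z + b • y)) hy (by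
      simp only [haa, hbb, form, Pi.add_apply, Pi.smul_apply, smul_eq_mul] at hy ⊢
      linear_combination (x 0 * y 0 + x 1 * y 1 + x 2 * y 2 - x 3 * y 3
        + t * (y 0 * z 0 + y 1 * z 1 + y 2 * z 2 - y 3 * z 3)) * hy)).1
    have e : form ((x + a • y) + t • (z + b • y)) ((x + a • y) + t • (z + b • y)) =
        form x x + t ^ 2 * form z z + (a + t * b) ^ 2 * form y y
          + 2 * t * form x z + 2 * (a + t * b) * form x y + 2 * t * (a + t * b) * form y z := by
      simp only [form, Pi.add_apply, Pi.smul_apply, smul_eq_mul]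
      ring
    rw [e, hx, hy, hz, ← haa, ← hbb, ← hcc] at h
    linarith
  have hd := discrim_le_zero key
  rw [discrim] at hd
  have h2 : (c + a * b) ^ 2 ≤ ((-a) ^ 2 - 1) * ((-b) ^ 2 - 1) := by nlinarith
  have h3 : |c + a * b| ≤ √((-a) ^ 2 - 1) * √((-b) ^ 2 - 1) := by
    rw [← Real.sqrt_mul (by nlinarith)]
    exact Real.abs_le_sqrt h2
  have h4 := (abs_le.1 h3).1
  linarith

protected theorem eq_of_dist_eq_zero {x y : H3} (h : dist x y = 0) : x = y := by
  rw [dist_def, Real.arcosh_eq_zero_iff (one_le_neg_form x y)] at h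
  obtain ⟨x, hx, hx3⟩ := x
  obtain ⟨y, hy, hy3⟩ := y
  apply Subtype.ext
  simp only at h ⊢
  have hs := form_self_nonneg_of_orthogonal (u := x - y) hy (by
    simp only [form, Pi.sub_apply] at h hy ⊢
    linarith)
  refine sub_eq_zero.1 (hs.2 ?_)
  simp only [form, Pi.sub_apply] at h hx hy ⊢
  linarith

instance : MetricSpace H3 where
  dist_self := H3.dist_self
  dist_comm := H3.dist_comm
  dist_triangle := H3.dist_triangle
  eq_of_dist_eq_zero := H3.eq_of_dist_eq_zero

end H3

/-- The group SO⁺(3,1) of orientation-preserving isometries of hyperbolic 3-space: the linear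
automorphisms of Minkowski space that preserve the Lorentz form and the upper sheet of the
hyperboloid and have determinant 1. -/
def SO31 : Subgroup (Mink ≃ₗ[ℝ] Mink) where
  carrier := {A | (∀ x y, form (A x) (A y) = form x y) ∧
    (∀ x, form x x = -1 → 0 < x 3 → 0 < A x 3) ∧ LinearEquiv.det A = 1}
  one_mem' := ⟨fun _ _ => rfl, fun _ _ h => h, map_one _⟩
  mul_mem' := by
    rintro A B ⟨hA, hA', hA''⟩ ⟨hB, hB', hB''⟩
    refine ⟨fun x y => ?_, fun x hx h => ?_, ?_⟩
    · rw [LinearEquiv.mul_apply, LinearEquiv.mul_apply, hA, hB]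
    · exact hA' _ ((hB x x).trans hx) (hB' x hx h)
    · rw [map_mul, hA'', hB'', one_mul]
  inv_mem' := by
    rintro A ⟨hA, hA', hA''⟩
    have hinv : ∀ x, A (A⁻¹ x) = x := fun x => A.apply_symm_apply x
    have hform : ∀ x y, form (A⁻¹ x) (A⁻¹ y) = form x y := fun x y => by
      rw [← hA, hinv, hinv]
    refine ⟨hform, fun x hx h => ?_, ?_⟩
    · have hx' : form (A⁻¹ x) (A⁻¹ x) = -1 := by rw [hform, hx]
      rcases lt_trichotomy ((A⁻¹ x) 3) 0 with hneg | h0 | hpos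
      · have := hA' (-(A⁻¹ x)) (by rw [form_neg_neg, hx'])
          (by rw [Pi.neg_apply]; linarith)
        rw [map_neg, hinv, Pi.neg_apply] at this
        linarith
      · simp only [form, h0] at hx'
        nlinarith [mul_self_nonneg ((A⁻¹ x) 0), mul_self_nonneg ((A⁻¹ x) 1),
          mul_self_nonneg ((A⁻¹ x) 2)]
      · exact hpos
    · rw [map_inv, hA'', inv_one]

instance : MulAction SO31 H3 where
  smul A x := ⟨A.1 x.1, by rw [A.2.1, x.2.1], A.2.2.1 _ x.2.1 x.2.2⟩
  one_smul _ := rfl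
  mul_smul _ _ _ := rfl

theorem coe_smul (A : SO31) (x : H3) : (A • x).1 = A.1 x.1 := rfl

theorem dist_smul_smul (A : SO31) (x y : H3) : dist (A • x) (A • y) = dist x y := by
  rw [H3.dist_def, H3.dist_def, coe_smul, coe_smul, A.2.1]

/-- The translation length `inf_x dist x (A x)` of an isometry of hyperbolic 3-space. -/
def translationLength (A : SO31) : ℝ := ⨅ x : H3, dist x (A • x)

/-- A group of isometries is elementary if it has a finite orbit in the closed ball
`H³ ∪ ∂H³`. In the projective (Klein) model the points of the closed ball are the lines spanned
by nonzero vectors `v` with `⟨v, v⟩ ≤ 0`; those with `⟨v, v⟩ = 0` form the sphere at infinity. -/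
def IsElementary (Γ : Subgroup SO31) : Prop :=
  ∃ v : Mink, v ≠ 0 ∧ form v v ≤ 0 ∧
    (Set.range fun γ : Γ => Submodule.span ℝ {γ.1.1 v}).Finite

/-- A (connected, complete) orientable hyperbolic 3-manifold `H³ / Γ`, given by its group `Γ` of
deck transformations: orientation-preserving isometries of `H³` acting freely and properly
discontinuously. As closed balls of `H³` are compact, the last condition says that only finitely
many elements move a compact set to a set that meets it. -/
structure Manifold where
  /-- The deck group of the universal covering, i.e. the fundamental group. -/
  deck : Subgroup SO31
  free : ∀ (γ : deck) (x : H3), γ • x = x → γ = 1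
  properlyDiscontinuous : ∀ (x : H3) (r : ℝ), {γ : deck | dist x (γ • x) ≤ r}.Finite

namespace Manifold

variable (M : Manifold)

/-- The manifold is nonelementary if its group is. -/
def Nonelementary : Prop := ¬ IsElementary M.deck

/-- The length of the class of `γ` in the fundamental group: the length of the closed geodesic
freely homotopic to `γ`, and 0 if there is none (`γ` trivial or parabolic). -/
def length (γ : M.deck) : ℝ := translationLength γ.1

/-- Two manifolds have the same marked length spectrum if some isomorphism of their fundamental
groups preserves the length of every element. -/
def SameMarkedLengthSpectrum (M N : Manifold) : Prop :=
  ∃ φ : M.deck ≃* N.deck, ∀ γ : M.deck, N.length (φ γ) = M.length γ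

/-- The underlying space: the set of orbits of the deck group in `H³`. -/
def Carrier : Type := MulAction.orbitRel.Quotient M.deck H3

/-- The covering projection. -/
def proj (x : H3) : M.Carrier := Quotient.mk _ x

theorem proj_eq_iff {x y : H3} : M.proj x = M.proj y ↔ ∃ γ : M.deck, γ • y = x :=
  Quotient.eq.trans MulAction.orbitRel_apply

theorem dist_deck (γ : M.deck) (x y : H3) : dist (γ • x) (γ • y) = dist x y :=
  dist_smul_smul γ.1 x y

/-- Distance between orbits. -/
def orbitDist (x y : H3) : ℝ := ⨅ γ : M.deck, dist x (γ • y)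

theorem bddBelow_orbitDist (x y : H3) :
    BddBelow (Set.range fun γ : M.deck => dist x (γ • y)) :=
  ⟨0, by rintro _ ⟨γ, rfl⟩; exact dist_nonneg⟩

theorem orbitDist_smul_right (δ : M.deck) (x y : H3) :
    M.orbitDist x (δ • y) = M.orbitDist x y := by
  unfold orbitDist
  refine (Equiv.mulRight δ).iInf_congr fun γ => ?_
  rw [Equiv.coe_mulRight, mul_smul]

theorem orbitDist_comm (x y : H3) : M.orbitDist x y = M.orbitDist y x := by
  unfold orbitDist
  refine (Equiv.inv M.deck).iInf_congr fun γ => ?_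
  rw [Equiv.inv_apply, ← M.dist_deck γ, smul_inv_smul, dist_comm]

theorem orbitDist_smul_left (δ : M.deck) (x y : H3) :
    M.orbitDist (δ • x) y = M.orbitDist x y := by
  rw [orbitDist_comm, orbitDist_smul_right, orbitDist_comm]

theorem orbitDist_triangle (x y z : H3) :
    M.orbitDist x z ≤ M.orbitDist x y + M.orbitDist y z := by
  refine le_ciInf_add_ciInf fun γ δ => ?_
  refine (ciInf_le (M.bddBelow_orbitDist x z) (γ * δ)).trans ?_
  rw [← M.dist_deck γ y, mul_smul]
  exact dist_triangle _ _ _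

theorem exists_orbitDist_eq (x y : H3) :
    ∃ γ : M.deck, M.orbitDist x y = dist x (γ • y) := by
  have hfin : {γ : M.deck | dist x (γ • y) ≤ dist x y}.Finite := by
    refine (M.properlyDiscontinuous y (dist x y + dist x y)).subset fun γ hγ => ?_
    have h := dist_triangle y x (γ • y)
    rw [dist_comm y x] at h
    exact h.trans (by simpa using hγ)
  obtain ⟨γ, hγ, hmin⟩ := Set.exists_min_image _ (fun γ : M.deck => dist x (γ • y)) hfin
    ⟨1, by simp⟩
  refine ⟨γ, le_antisymm (ciInf_le (M.bddBelow_orbitDist x y) γ) (le_ciInf fun δ => ?_)⟩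
  by_cases hδ : dist x (δ • y) ≤ dist x y
  · exact hmin δ hδ
  · exact le_trans hγ (not_le.1 hδ).le

/-- The quotient metric: the distance of two points is the infimum (here a minimum) of the
distances of their lifts. It is the distance of the hyperbolic Riemannian metric. -/
instance : MetricSpace M.Carrier where
  dist := Quotient.lift₂ M.orbitDist (by
    rintro _ _ x y ⟨γ, rfl⟩ ⟨δ, rfl⟩
    exact (M.orbitDist_smul_left γ _ _).trans (M.orbitDist_smul_right δ _ _))
  dist_self := by
    rintro ⟨x⟩
    obtain ⟨γ, hγ⟩ := M.exists_orbitDist_eq x x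
    refine le_antisymm ((ciInf_le (M.bddBelow_orbitDist x x) 1).trans ?_) ?_
    · simp
    · exact dist_nonneg.trans_eq hγ.symm
  dist_comm := by
    rintro ⟨x⟩ ⟨y⟩
    exact M.orbitDist_comm x y
  dist_triangle := by
    rintro ⟨x⟩ ⟨y⟩ ⟨z⟩
    exact M.orbitDist_triangle x y z
  eq_of_dist_eq_zero := by
    rintro ⟨x⟩ ⟨y⟩ h
    obtain ⟨γ, hγ⟩ := M.exists_orbitDist_eq x y
    exact M.proj_eq_iff.2 ⟨γ, (dist_eq_zero.1 (hγ.symm.trans h)).symm⟩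

theorem dist_proj (x y : H3) :
    dist (M.proj x) (M.proj y) = ⨅ γ : M.deck, dist x (γ • y) := rfl

end Manifold

end

end Hyp3

open Filter Topology

namespace Hyp3

noncomputable section

/-! ### The Lorentz form -/

/-! The marked length spectrum determines enough Lorentz products to reconstruct the group by linear
algebra in Minkowski space.

A nonelementary discrete group contains an element `g` of positive length `ℓ`
(`Manifold.Nonelementary.exists_translationLength_pos`). The ends of its axis are spanned by null
vectors `a`, `r` with `⟨a, r⟩ = -1`, and `e^(-nℓ) g ^ n` tends to the rank one map `x ↦ -⟨x, r⟩ a`.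
Hence `e^(-nℓ) g ^ n γ` tends to a map of trace `-⟨γ a, r⟩`, and translation length is, up to
bounded factors, the logarithm of the growth of traces of powers. So the lengths of all `g ^ n γ`
determine `⟨γ a, r⟩` (`IsAxis.neg_form_le`), and `⟨γ a, δ r⟩ = ⟨φ(γ) a', φ(δ) r'⟩` for all `γ`, `δ`,
where `a'`, `r'` belong to the axis of `φ g`.

The orbits of `a` and `r` span the same subspace, on which the form is nondegenerate. Equality of
the pairings therefore makes `γ a ↦ φ(γ) a'` a well-defined equivariant linear map, which multiplies
the form by a positive constant and can be rescaled to an isometry (`exists_equivariant_on_span`).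
The span has dimension 3 or 4. If it is a hyperplane, as for Fuchsian groups, the map is extended by
unit normals, and determinant one forces equivariance of the extension (`exists_equivariant`). The
resulting linear isometry conjugates the two groups, with no control on its own determinant, and
descends to the quotients. -/

theorem form_add_left (x y z : Mink) : form (x + y) z = form x z + form y z := by
  simp only [form, Pi.add_apply]; ring

theorem form_add_right (x y z : Mink) : form x (y + z) = form x y + form x z := by
  simp only [form, Pi.add_apply]; ring

theorem form_sub_left (x y z : Mink) : form (x - y) z = form x z - form y z := by
  simp only [form, Pi.sub_apply]; ring

theorem form_sub_right (x y z : Mink) : form x (y - z) = form x y - form x z := by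
  simp only [form, Pi.sub_apply]; ring

theorem form_smul_left (c : ℝ) (x y : Mink) : form (c • x) y = c * form x y := by
  simp only [form, Pi.smul_apply, smul_eq_mul]; ring

theorem form_smul_right (c : ℝ) (x y : Mink) : form x (c • y) = c * form x y := by
  simp only [form, Pi.smul_apply, smul_eq_mul]; ring

theorem form_neg_left (x y : Mink) : form (-x) y = -form x y := by
  simp only [form, Pi.neg_apply]; ring

theorem form_neg_right (x y : Mink) : form x (-y) = -form x y := by
  simp only [form, Pi.neg_apply]; ring

theorem form_zero_left (y : Mink) : form 0 y = 0 := by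
  simp [form]

theorem form_zero_right (y : Mink) : form y 0 = 0 := by
  simp [form]

/-- The Lorentz form as a bilinear map. -/
def formₗ : Mink →ₗ[ℝ] Mink →ₗ[ℝ] ℝ :=
  LinearMap.mk₂ ℝ form form_add_left form_smul_left form_add_right form_smul_right

theorem formₗ_apply (x y : Mink) : formₗ x y = form x y := rfl

theorem form_single_three (x : Mink) : form x (Pi.single 3 1) = -x 3 := by
  simp [form]

theorem eq_zero_of_form_eq_zero {x : Mink} (h : ∀ y, form x y = 0) : x = 0 := by
  have h0 := h (Pi.single 0 1)
  have h1 := h (Pi.single 1 1)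
  have h2 := h (Pi.single 2 1)
  have h3 := h (Pi.single 3 1)
  simp [form] at h0 h1 h2 h3
  ext i
  fin_cases i <;> simp [h0, h1, h2, h3]

theorem ext_form {x y : Mink} (h : ∀ z, form x z = form y z) : x = y :=
  sub_eq_zero.1 (eq_zero_of_form_eq_zero fun z => by rw [form_sub_left, h, sub_self])

theorem continuous_form : Continuous fun p : Mink × Mink => form p.1 p.2 := by
  unfold form; fun_prop

theorem eq_zero_of_null {x : Mink} (h : form x x = 0) (h3 : x 3 = 0) : x = 0 := by
  simp only [form, h3] at h
  have h0 : x 0 = 0 := by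
    nlinarith [mul_self_nonneg (x 0), mul_self_nonneg (x 1), mul_self_nonneg (x 2)]
  have h1 : x 1 = 0 := by
    nlinarith [mul_self_nonneg (x 0), mul_self_nonneg (x 1), mul_self_nonneg (x 2)]
  have h2 : x 2 = 0 := by
    nlinarith [mul_self_nonneg (x 0), mul_self_nonneg (x 1), mul_self_nonneg (x 2)]
  ext i
  fin_cases i <;> simp [h0, h1, h2, h3]

/-- Orthogonal null vectors are proportional. -/
theorem eq_smul_of_null {u v : Mink} (hu : form u u = 0) (hv : form v v = 0)
    (h : form u v = 0) (hu0 : u 3 ≠ 0) : v = (v 3 / u 3) • u := by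
  refine sub_eq_zero.1 (eq_zero_of_null ?_ ?_)
  · rw [form_sub_left, form_sub_right, form_sub_right, form_smul_left, form_smul_left,
      form_smul_right, form_smul_right, hu, hv, h, form_comm v u, h]
    ring
  · simp [hu0]

/-- Nonzero future-pointing null vectors. -/
structure FutureNull (a : Mink) : Prop where
  null : form a a = 0
  pos : 0 < a 3

theorem form_nonpos {u v : Mink} (hu : form u u ≤ 0) (hv : form v v ≤ 0) (hu3 : 0 < u 3)
    (hv3 : 0 < v 3) : form u v ≤ 0 := by
  simp only [form] at *
  have cs : (u 0 * v 0 + u 1 * v 1 + u 2 * v 2) ^ 2 ≤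
      (u 0 * u 0 + u 1 * u 1 + u 2 * u 2) * (v 0 * v 0 + v 1 * v 1 + v 2 * v 2) := by
    nlinarith [sq_nonneg (u 0 * v 1 - u 1 * v 0), sq_nonneg (u 0 * v 2 - u 2 * v 0),
      sq_nonneg (u 1 * v 2 - u 2 * v 1)]
  have h2 : (u 0 * u 0 + u 1 * u 1 + u 2 * u 2) * (v 0 * v 0 + v 1 * v 1 + v 2 * v 2) ≤
      (u 3 * u 3) * (v 3 * v 3) :=
    mul_le_mul (by linarith) (by linarith)
      (by linarith [mul_self_nonneg (v 0), mul_self_nonneg (v 1), mul_self_nonneg (v 2)])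
      (mul_self_nonneg _)
  have := abs_le_of_sq_le_sq' (a := u 0 * v 0 + u 1 * v 1 + u 2 * v 2) (b := u 3 * v 3)
    (by nlinarith) (by positivity)
  linarith [this.2]

namespace FutureNull

variable {a b : Mink}

theorem smul (ha : FutureNull a) {c : ℝ} (hc : 0 < c) : FutureNull (c • a) :=
  ⟨by rw [form_smul_left, form_smul_right, ha.null]; ring, by simpa using mul_pos hc ha.pos⟩

theorem ne_zero (ha : FutureNull a) : a ≠ 0 := by
  rintro rfl
  simpa using ha.pos

theorem form_nonpos (ha : FutureNull a) (hb : FutureNull b) : form a b ≤ 0 :=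
  Hyp3.form_nonpos ha.null.le hb.null.le ha.pos hb.pos

theorem form_neg (ha : FutureNull a) (x : H3) : form x.1 a < 0 := by
  refine lt_of_le_of_ne
    (Hyp3.form_nonpos (by rw [x.2.1]; norm_num) ha.null.le x.2.2 ha.pos) fun h => ?_
  exact ha.ne_zero ((H3.form_self_nonneg_of_orthogonal x.2.1 (by rwa [form_comm])).2 ha.null)

theorem eq_smul (ha : FutureNull a) (hb : FutureNull b) (h : form a b = 0) :
    ∃ c : ℝ, 0 < c ∧ b = c • a :=
  ⟨b 3 / a 3, div_pos hb.pos ha.pos, eq_smul_of_null ha.null hb.null h ha.pos.ne'⟩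

end FutureNull

/-! ### Lorentz transformations -/

/-- The base point of hyperbolic space. -/
def H3.base : H3 := ⟨Pi.single 3 1, by simp [form], by simp⟩

theorem SO31.form_apply (A : SO31) (x y : Mink) : form (A.1 x) (A.1 y) = form x y := A.2.1 x y

theorem SO31.apply_inv (A : SO31) (x : Mink) : A.1 (A⁻¹.1 x) = x := A.1.apply_symm_apply x

theorem SO31.inv_apply (A : SO31) (x : Mink) : A⁻¹.1 (A.1 x) = x := A.1.symm_apply_apply x

theorem SO31.form_apply_left (A : SO31) (x y : Mink) :
    form (A.1 x) y = form x (A⁻¹.1 y) := by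
  rw [← SO31.form_apply A x, SO31.apply_inv A]

theorem SO31.mul_apply (A B : SO31) (x : Mink) : (A * B).1 x = A.1 (B.1 x) := rfl

theorem FutureNull.apply {a : Mink} (ha : FutureNull a) (A : SO31) : FutureNull (A.1 a) := by
  have hn : form (A.1 a) (A.1 a) = 0 := by rw [SO31.form_apply A, ha.null]
  refine ⟨hn, lt_of_not_ge fun h => ?_⟩
  have h0 : A.1 a 3 ≠ 0 := fun h0 =>
    ha.ne_zero (A.1.map_eq_zero_iff.1 (eq_zero_of_null hn h0))
  have h1 : FutureNull (-A.1 a) := ⟨by rw [form_neg_neg, hn], by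
    rw [Pi.neg_apply]; exact neg_pos.2 (lt_of_le_of_ne h h0)⟩
  -- A null vector sent to the past cone would have positive product with the image of the base
  -- point, yet products are preserved.
  have h2 := h1.form_neg (A • H3.base)
  rw [coe_smul, form_neg_right, SO31.form_apply A] at h2
  linarith [ha.form_neg H3.base]

/-- The matrix of a Lorentz transformation. -/
def SO31.mat : SO31 →* Matrix (Fin 4) (Fin 4) ℝ where
  toFun A := LinearMap.toMatrix' A.1.toLinearMap
  map_one' := LinearMap.toMatrix'_one
  map_mul' A B := LinearMap.toMatrix'_mul A.1.toLinearMap B.1.toLinearMap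

theorem SO31.mat_mulVec (A : SO31) (x : Mink) : (SO31.mat A).mulVec x = A.1 x :=
  LinearMap.toMatrix'_mulVec A.1.toLinearMap x

theorem SO31.mat_apply (A : SO31) (i j : Fin 4) : SO31.mat A i j = A.1 (Pi.single j 1) i := by
  rw [← SO31.mat_mulVec A]; simp

/-- The entries of the matrix of an isochronous Lorentz transformation are bounded by the last
one. -/
theorem abs_apply_single_le (A : Mink ≃ₗ[ℝ] Mink) (hA : ∀ x y, form (A x) (A y) = form x y)
    (h3 : 0 < A (Pi.single 3 1) 3) (i j : Fin 4) :
    |A (Pi.single j 1) i| ≤ A (Pi.single 3 1) 3 := by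
  have hs : ∀ x y, form (A.symm x) (A.symm y) = form x y := fun x y => by
    rw [← hA, A.apply_symm_apply, A.apply_symm_apply]
  have hadj : ∀ x y, form (A x) y = form x (A.symm y) := fun x y => by
    rw [← hA x, A.apply_symm_apply]
  have hrow : ∀ j, A (Pi.single j 1) 3 = -form (Pi.single j 1) (A.symm (Pi.single 3 1)) :=
    fun j => by rw [← hadj, form_single_three, neg_neg]
  set b := A.symm (Pi.single 3 1) with hb
  have hbb : form b b = -1 := by rw [hb, hs]; simp [form]
  have c0 := hA (Pi.single 0 1) (Pi.single 0 1)
  have c1 := hA (Pi.single 1 1) (Pi.single 1 1)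
  have c2 := hA (Pi.single 2 1) (Pi.single 2 1)
  have c3 := hA (Pi.single 3 1) (Pi.single 3 1)
  have r0 := hrow 0
  have r1 := hrow 1
  have r2 := hrow 2
  have r3 := hrow 3
  simp only [form, Pi.single_apply] at c0 c1 c2 c3 r0 r1 r2 r3 hbb
  simp at c0 c1 c2 c3 r0 r1 r2 r3
  rw [r0] at c0
  rw [r1] at c1
  rw [r2] at c2
  rw [r3] at c3
  -- The time row is read off from the unit timelike vector `b`. A spatial column has squared
  -- spatial length `1 + b j ^ 2`, at most `b 3 ^ 2`; the time column has `b 3 ^ 2 - 1`.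
  have hsq : |A (Pi.single j 1) i| ^ 2 ≤ A (Pi.single 3 1) 3 ^ 2 := by
    rw [sq_abs, r3]
    clear_value b
    have p (x : ℝ) := mul_self_nonneg x
    fin_cases j <;> fin_cases i <;>
      simp only [Fin.zero_eta, Fin.mk_one, Fin.reduceFinMk, r0, r1, r2, r3] <;>
      linarith [p (b 0), p (b 1), p (b 2), p (A (Pi.single 0 1) 0), p (A (Pi.single 0 1) 1),
        p (A (Pi.single 0 1) 2), p (A (Pi.single 1 1) 0), p (A (Pi.single 1 1) 1),
        p (A (Pi.single 1 1) 2), p (A (Pi.single 2 1) 0), p (A (Pi.single 2 1) 1),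
        p (A (Pi.single 2 1) 2), p (A (Pi.single 3 1) 0), p (A (Pi.single 3 1) 1),
        p (A (Pi.single 3 1) 2)]
  exact (sq_le_sq₀ (abs_nonneg _) h3.le).1 hsq

theorem cosh_dist (x y : H3) : Real.cosh (dist x y) = -form x.1 y.1 := by
  rw [H3.dist_def, Real.cosh_arcosh (H3.one_le_neg_form x y)]

theorem SO31.mat_three_three (A : SO31) :
    SO31.mat A 3 3 = Real.cosh (dist H3.base (A • H3.base)) := by
  rw [cosh_dist, form_comm, coe_smul, SO31.mat_apply A]
  exact (neg_eq_iff_eq_neg.2 (form_single_three _)).symm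

theorem SO31.mat_three_three_pos (A : SO31) : 0 < SO31.mat A 3 3 := by
  rw [SO31.mat_three_three A]; exact Real.cosh_pos _

theorem SO31.abs_mat_le (A : SO31) (i j : Fin 4) : |SO31.mat A i j| ≤ SO31.mat A 3 3 := by
  have h := SO31.mat_three_three_pos A
  rw [SO31.mat_apply A] at h ⊢
  rw [SO31.mat_apply A]
  exact abs_apply_single_le A.1 A.2.1 h i j

theorem SO31.exp_dist_le (A : SO31) :
    Real.exp (dist H3.base (A • H3.base)) ≤ 2 * SO31.mat A 3 3 := by
  rw [SO31.mat_three_three A, Real.cosh_eq]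
  linarith [Real.exp_pos (-dist H3.base (A • H3.base))]

/-- The reflection in the hyperplane orthogonal to a non-null vector. -/
def reflection (w : Mink) (hw : form w w ≠ 0) : Mink ≃ₗ[ℝ] Mink :=
  LinearEquiv.ofInvolutive
    (LinearMap.id - (2 / form w w) • (formₗ w).smulRight w) fun x => by
      simp only [LinearMap.sub_apply, LinearMap.id_apply, LinearMap.smul_apply,
        LinearMap.smulRight_apply, formₗ_apply, form_sub_right, form_smul_right]
      match_scalars
      · ring
      · field_simp
        ring

theorem reflection_apply (w : Mink) (hw : form w w ≠ 0) (x : Mink) :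
    reflection w hw x = x - (2 / form w w) • form w x • w := rfl

theorem form_reflection (w : Mink) (hw : form w w ≠ 0) (x y : Mink) :
    form (reflection w hw x) (reflection w hw y) = form x y := by
  rw [reflection_apply, reflection_apply]
  simp only [form_sub_right, form_sub_left, form_smul_left, form_smul_right, form_comm w x]
  field_simp
  ring

/-- The trace is conjugation invariant, so `x` may be moved to the base point, where every matrix
entry is at most `cosh` of the displacement. -/
theorem SO31.abs_trace_le_exp_dist (A : SO31) (x : H3) :
    |(SO31.mat A).trace| ≤ 4 * Real.exp (dist x (A • x)) := by
  have hxo := H3.one_le_neg_form x H3.base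
  -- The reflection in `x + o` sends `o` to `-x`; the sign cancels in every product below.
  set w : Mink := x.1 + H3.base.1 with hw
  have hww : form w w = -2 + 2 * form x.1 H3.base.1 := by
    simp only [hw, form_add_left, form_add_right, x.2.1, H3.base.2.1,
      form_comm H3.base.1 x.1]
    ring
  have hw0 : form w w ≠ 0 := by linarith
  set S := reflection w hw0 with hS
  have hSo : S (Pi.single 3 1) = -x.1 := by
    change S H3.base.1 = _
    rw [hS, reflection_apply, smul_smul]
    have : form w H3.base.1 = form w w / 2 := by
      rw [hww, hw, form_add_left, H3.base.2.1]; ring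
    rw [this, div_mul_div_comm, mul_comm, div_self (by positivity), one_smul, hw]
    abel
  set C : Mink ≃ₗ[ℝ] Mink := S.symm.trans (A.1.trans S) with hC
  have hCf : ∀ x y, form (C x) (C y) = form x y := fun x y => by
    have : ∀ x y, form (S.symm x) (S.symm y) = form x y := fun x y => by
      rw [← form_reflection w hw0, ← hS, S.apply_symm_apply, S.apply_symm_apply]
    simp only [hC, LinearEquiv.trans_apply]
    rw [hS, form_reflection, SO31.form_apply A, ← hS, this]
  have hC3 : C (Pi.single 3 1) 3 = Real.cosh (dist x (A • x)) := by
    rw [← neg_neg (C (Pi.single 3 1) 3), ← form_single_three, cosh_dist, coe_smul]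
    have h1 : S.symm (Pi.single 3 1) = S (Pi.single 3 1) := rfl
    have h2 : (Pi.single 3 1 : Mink) = S (S.symm (Pi.single 3 1)) := (S.apply_symm_apply _).symm
    conv_lhs => rw [h2]
    rw [hC, LinearEquiv.trans_apply, LinearEquiv.trans_apply, S.symm_apply_apply, hS,
      form_reflection, ← hS, h1, hSo, map_neg, form_neg_neg, form_comm]
  have htr : (SO31.mat A).trace = LinearMap.trace ℝ Mink C.toLinearMap := by
    have : C.toLinearMap = S.conj A.1.toLinearMap := by ext; rfl
    rw [this, LinearMap.trace_conj', ← Matrix.trace_toLin'_eq]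
    congr 1
    exact Matrix.toLin'_toMatrix' _
  have hbd : ∀ i, |C (Pi.single i 1) i| ≤ Real.exp (dist x (A • x)) := fun i => by
    refine (abs_apply_single_le C hCf (by rw [hC3]; exact Real.cosh_pos _) i i).trans ?_
    rw [hC3, Real.cosh_eq]
    have : Real.exp (-dist x (A • x)) ≤ Real.exp (dist x (A • x)) :=
      Real.exp_le_exp.2 (by linarith [dist_nonneg (x := x) (y := A • x)])
    linarith
  rw [htr, LinearMap.trace_eq_matrix_trace ℝ (Pi.basisFun ℝ (Fin 4)), Matrix.trace]
  have hsum : ∑ i : Fin 4, |C (Pi.single i 1) i| ≤ 4 * Real.exp (dist x (A • x)) := by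
    simpa using Finset.sum_le_card_nsmul Finset.univ _ _ fun i _ => hbd i
  refine (Finset.abs_sum_le_sum_abs _ _).trans ?_
  simpa [LinearMap.toMatrix_apply] using hsum

/-! ### Translation length -/

theorem translationLength_le (A : SO31) (x : H3) : translationLength A ≤ dist x (A • x) :=
  ciInf_le ⟨0, by rintro _ ⟨x, rfl⟩; exact dist_nonneg⟩ x

theorem le_translationLength {A : SO31} {c : ℝ} (h : ∀ x : H3, c ≤ dist x (A • x)) :
    c ≤ translationLength A :=
  have : Nonempty H3 := ⟨H3.base⟩
  le_ciInf h

theorem translationLength_nonneg (A : SO31) : 0 ≤ translationLength A :=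
  le_translationLength fun _ => dist_nonneg

/-- The bound at each point passes to the infimum after taking logarithms, which requires a nonzero
trace. -/
theorem SO31.abs_trace_le (A : SO31) :
    |(SO31.mat A).trace| ≤ 4 * Real.exp (translationLength A) := by
  rcases eq_or_lt_of_le (abs_nonneg (SO31.mat A).trace) with h | h
  · rw [← h]; positivity
  · have h2 : Real.log (|(SO31.mat A).trace| / 4) ≤ translationLength A :=
      le_translationLength fun x => by
        rw [Real.log_le_iff_le_exp (by positivity)]
        linarith [SO31.abs_trace_le_exp_dist A x]
    rw [Real.log_le_iff_le_exp (by positivity)] at h2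
    linarith

theorem dist_pow_smul_le (A : SO31) (x : H3) (k : ℕ) :
    dist x (A ^ k • x) ≤ k * dist x (A • x) := by
  induction k with
  | zero => simp
  | succ k ih =>
    have h := dist_triangle x (A ^ k • x) (A ^ (k + 1) • x)
    rw [pow_succ, mul_smul, dist_smul_smul] at h
    rw [pow_succ, mul_smul]
    push_cast
    linarith

theorem translationLength_pow_le (A : SO31) (k : ℕ) :
    translationLength (A ^ k) ≤ k * translationLength A := by
  rcases Nat.eq_zero_or_pos k with rfl | hk
  · have := translationLength_le (A ^ 0) H3.base
    simpa using this
  · have hk' : (0 : ℝ) < k := by exact_mod_cast hk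
    rw [← div_le_iff₀' hk']
    refine le_translationLength fun x => ?_
    rw [div_le_iff₀' hk']
    exact (translationLength_le _ x).trans (dist_pow_smul_le A x k)

/-- A point of the interior of the future cone, projected to the hyperboloid. -/
def H3.normalize (v : Mink) (hv : form v v < 0) (hv3 : 0 < v 3) : H3 :=
  ⟨(√(-form v v))⁻¹ • v, by
    rw [form_smul_left, form_smul_right, ← mul_assoc, ← mul_inv,
      Real.mul_self_sqrt (by linarith), inv_mul_eq_div, div_neg, div_self hv.ne], by
    have : 0 < √(-form v v) := Real.sqrt_pos.2 (by linarith)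
    rw [Pi.smul_apply, smul_eq_mul]
    positivity⟩

theorem cosh_dist_normalize (A : SO31) (v : Mink) (hv : form v v < 0) (hv3 : 0 < v 3) :
    Real.cosh (dist (H3.normalize v hv hv3) (A • H3.normalize v hv hv3)) =
      form v (A.1 v) / form v v := by
  rw [cosh_dist, coe_smul, H3.normalize]
  simp only [map_smul, form_smul_left, form_smul_right]
  rw [← mul_assoc, ← mul_inv, Real.mul_self_sqrt (by linarith)]
  field_simp

/-- The comparison of a midpoint segment with half of the base of a triangle. -/
theorem two_mul_translationLength_le (A : SO31) :
    2 * translationLength A ≤ translationLength (A ^ 2) := by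
  refine le_translationLength fun x => ?_
  set y : H3 := A • x with hy
  set D := dist x (A ^ 2 • x) with hD
  have hAy : A ^ 2 • x = A • y := by rw [pow_two, mul_smul]
  have ha : Real.cosh (D / 2) ≤ -form x.1 y.1 := by
    rw [← cosh_dist, Real.cosh_le_cosh, abs_of_nonneg dist_nonneg,
      abs_of_nonneg (by positivity)]
    have := dist_triangle x y (A • y)
    rw [← hAy, ← hD, hAy] at this
    have h2 : dist y (A • y) = dist x y := by rw [hy, dist_smul_smul]
    linarith
  have hc : -form x.1 (A.1 y.1) = 2 * Real.cosh (D / 2) ^ 2 - 1 := by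
    rw [← coe_smul, ← hAy, ← cosh_dist, ← hD]
    conv_lhs => rw [← mul_div_cancel₀ D (two_ne_zero), Real.cosh_two_mul]
    rw [Real.sinh_sq]; ring
  have hyy : form y.1 (A.1 y.1) = form x.1 y.1 := by
    rw [hy, coe_smul, SO31.form_apply A]
  set v := x.1 + y.1 with hv
  have hvv : form v v = -2 + 2 * form x.1 y.1 := by
    simp only [hv, form_add_left, form_add_right, x.2.1, y.2.1, form_comm y.1 x.1]
    ring
  have hvA : form v (A.1 v) = 2 * form x.1 y.1 - 1 + form x.1 (A.1 y.1) := by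
    have h1 : A.1 x.1 = y.1 := rfl
    simp only [hv, map_add, form_add_left, form_add_right, hyy, h1, y.2.1]
    ring
  have hC := Real.one_le_cosh (D / 2)
  have hneg : form v v < 0 := by linarith
  have h3 : 0 < v 3 := add_pos x.2.2 y.2.2
  have hm := translationLength_le A (H3.normalize v hneg h3)
  have hcosh := cosh_dist_normalize A v hneg h3
  set d := dist (H3.normalize v hneg h3) (A • H3.normalize v hneg h3) with hd
  -- With `p = -⟨x, y⟩` and `C = cosh (D / 2)` the quotient is `(p + C ^ 2) / (1 + p)`, which is at
  -- most `C` because `1 ≤ C ≤ p`.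
  have hle : Real.cosh d ≤ Real.cosh (D / 2) := by
    rw [hcosh, div_le_iff_of_neg hneg, hvv, hvA]
    nlinarith
  rw [Real.cosh_le_cosh, abs_of_nonneg dist_nonneg, abs_of_nonneg (by positivity)] at hle
  linarith

theorem two_pow_mul_translationLength_le (A : SO31) (k : ℕ) :
    2 ^ k * translationLength A ≤ translationLength (A ^ 2 ^ k) := by
  induction k with
  | zero => simp
  | succ k ih =>
    have := two_mul_translationLength_le (A ^ 2 ^ k)
    rw [← pow_mul, ← pow_succ] at this
    rw [pow_succ]
    linarith

/-! ### Rank one limits of Lorentz transformations -/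

theorem exists_form_eq (f : Mink →ₗ[ℝ] ℝ) : ∃ r, ∀ x, form x r = f x := by
  refine ⟨![f (Pi.single 0 1), f (Pi.single 1 1), f (Pi.single 2 1), -f (Pi.single 3 1)],
    fun x => ?_⟩
  conv_rhs => rw [LinearMap.pi_apply_eq_sum_univ f x]
  have hs : ∀ i : Fin 4, (fun j : Fin 4 => if i = j then (1 : ℝ) else 0) = Pi.single i 1 :=
    fun i => by ext j; simp [Pi.single_apply, eq_comm]
  simp only [hs, Fin.sum_univ_four, form, smul_eq_mul]
  simp

theorem tendsto_of_form {u : ℕ → Mink} {v : Mink}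
    (h : ∀ x, Tendsto (fun n => form x (u n)) atTop (𝓝 (form x v))) :
    Tendsto u atTop (𝓝 v) := by
  refine tendsto_pi_nhds.2 fun i => ?_
  fin_cases i
  · simpa [form] using h (Pi.single 0 1)
  · simpa [form] using h (Pi.single 1 1)
  · simpa [form] using h (Pi.single 2 1)
  · simpa [form] using (h (Pi.single 3 1)).neg

theorem tendsto_mulVec {M : ℕ → Matrix (Fin 4) (Fin 4) ℝ} {P : Matrix (Fin 4) (Fin 4) ℝ}
    (h : Tendsto M atTop (𝓝 P)) (x : Mink) :
    Tendsto (fun n => (M n).mulVec x) atTop (𝓝 (P.mulVec x)) :=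
  ((continuous_id.matrix_mulVec continuous_const).tendsto P).comp h

theorem tendsto_form_mulVec {M : ℕ → Matrix (Fin 4) (Fin 4) ℝ} {P : Matrix (Fin 4) (Fin 4) ℝ}
    (h : Tendsto M atTop (𝓝 P)) (x y : Mink) :
    Tendsto (fun n => form ((M n).mulVec x) y) atTop (𝓝 (form (P.mulVec x) y)) :=
  (continuous_form.tendsto _).comp ((tendsto_mulVec h x).prodMk_nhds tendsto_const_nhds)

theorem tendsto_trace {M : ℕ → Matrix (Fin 4) (Fin 4) ℝ} {P : Matrix (Fin 4) (Fin 4) ℝ}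
    (h : Tendsto M atTop (𝓝 P)) :
    Tendsto (fun n => (M n).trace) atTop (𝓝 P.trace) :=
  ((continuous_id.matrix_trace).tendsto P).comp h

theorem trace_of_mulVec_eq {P : Matrix (Fin 4) (Fin 4) ℝ} {f : Mink →ₗ[ℝ] ℝ} {a : Mink}
    (h : ∀ x, P.mulVec x = f x • a) : P.trace = f a := by
  have h1 : ∀ i, P i i = a i * f (Pi.single i 1) := fun i => by
    have := congrFun (h (Pi.single i 1)) i
    simpa [mul_comm] using this
  rw [LinearMap.pi_apply_eq_sum_univ f a, Matrix.trace]
  refine Finset.sum_congr rfl fun i _ => ?_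
  rw [Matrix.diag_apply, h1, smul_eq_mul]
  congr 2
  ext j; simp [Pi.single_apply, eq_comm]

theorem mul_self_of_mulVec_eq {P : Matrix (Fin 4) (Fin 4) ℝ} {f : Mink →ₗ[ℝ] ℝ} {a : Mink}
    (h : ∀ x, P.mulVec x = f x • a) : P * P = f a • P := by
  refine Matrix.ext_of_mulVec_single fun i => ?_
  rw [← Matrix.mulVec_mulVec, Matrix.smul_mulVec, h, h, map_smul, smul_smul, smul_eq_mul, mul_comm]

theorem pow_succ_of_mul_self {P : Matrix (Fin 4) (Fin 4) ℝ} {B : ℝ} (h : P * P = B • P) (k : ℕ) :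
    P ^ (k + 1) = B ^ k • P := by
  induction k with
  | zero => simp
  | succ k ih => rw [pow_succ, ih, Matrix.smul_mul, h, smul_smul, pow_succ]

/-- Taking roots removes the constant. Exponents that are powers of two suffice, and they are the
ones produced by repeated squaring of isometries. -/
theorem le_of_forall_two_pow_le {B B' C : ℝ} (hB' : 0 ≤ B')
    (h : ∀ j : ℕ, B ^ 2 ^ j ≤ C * B' ^ 2 ^ j) : B ≤ B' := by
  by_contra! hlt
  have hB : 0 < B := hB'.trans_lt hlt
  have h1 : Tendsto (fun j : ℕ => C * (B' / B) ^ 2 ^ j) atTop (𝓝 (C * 0)) :=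
    ((tendsto_pow_atTop_nhds_zero_of_lt_one (div_nonneg hB' hB.le) ((div_lt_one hB).2 hlt)).comp
      (tendsto_pow_atTop_atTop_of_one_lt (one_lt_two))).const_mul C
  have h2 : (1 : ℝ) ≤ C * 0 := ge_of_tendsto' h1 fun j => by
    rw [div_pow, ← mul_div_assoc, le_div_iff₀ (by positivity), one_mul]
    exact h j
  linarith

/-- Translation length controls the trace of rescaled rank one limits. -/
theorem le_of_translationLength_le {A A' : ℕ → SO31} {c : ℕ → ℝ} (hc : ∀ n, 0 ≤ c n)
    {P P' : Matrix (Fin 4) (Fin 4) ℝ} {B B' : ℝ}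
    (hP : Tendsto (fun n => c n • SO31.mat (A n)) atTop (𝓝 P))
    (hP' : Tendsto (fun n => c n • SO31.mat (A' n)) atTop (𝓝 P'))
    (hl : ∀ n, translationLength (A n) ≤ translationLength (A' n))
    (hB : P * P = B • P) (hB' : P' * P' = B' • P') (htr : P.trace = B) (hB0 : 0 ≤ B') :
    B ≤ B' := by
  -- Before the limit, trace, length and corner entry are chained: `tr ≤ 4 exp ℓ`, and `exp ℓ` is at
  -- most twice the corner entry, whence the 8.
  have key : ∀ j : ℕ, (P ^ 2 ^ j).trace ≤ 8 * (P' ^ 2 ^ j) 3 3 := fun j => by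
    have h1 := tendsto_trace (hP.pow (2 ^ j))
    have h2 : Tendsto (fun n => 8 * ((c n • SO31.mat (A' n)) ^ 2 ^ j) 3 3) atTop
        (𝓝 (8 * (P' ^ 2 ^ j) 3 3)) :=
      (((continuous_id.matrix_elem 3 3).tendsto _).comp (hP'.pow (2 ^ j))).const_mul 8
    refine le_of_tendsto_of_tendsto' h1 h2 fun n => ?_
    rw [smul_pow, smul_pow, Matrix.trace_smul, Matrix.smul_apply, smul_eq_mul, smul_eq_mul,
      ← map_pow, ← map_pow, mul_left_comm]
    refine mul_le_mul_of_nonneg_left ?_ (pow_nonneg (hc n) _)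
    have e1 := (le_abs_self _).trans (SO31.abs_trace_le (A n ^ 2 ^ j))
    have e2 := translationLength_pow_le (A n) (2 ^ j)
    have e3 := two_pow_mul_translationLength_le (A' n) j
    have e4 := translationLength_le (A' n ^ 2 ^ j) H3.base
    have e5 := SO31.exp_dist_le (A' n ^ 2 ^ j)
    have e6 : (2 : ℝ) ^ j * translationLength (A n) ≤ 2 ^ j * translationLength (A' n) :=
      mul_le_mul_of_nonneg_left (hl n) (by positivity)
    push_cast at e2
    have e7 := Real.exp_le_exp.2 (e2.trans (e6.trans (e3.trans e4)))
    linarith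
  have hk : ∀ j : ℕ, ∃ k : ℕ, 2 ^ j = k + 1 := fun j =>
    ⟨2 ^ j - 1, (Nat.sub_add_cancel Nat.one_le_two_pow).symm⟩
  rcases hB0.eq_or_lt with h0 | h0
  -- If `B' = 0` then `P'` squares to zero, and the first squaring already gives `B ^ 2 ≤ 0`.
  · have := key 1
    rw [pow_one, pow_succ_of_mul_self hB, pow_succ_of_mul_self hB', ← h0, Matrix.trace_smul,
      htr] at this
    simp at this
    nlinarith
  · refine le_of_forall_two_pow_le (C := 8 * P' 3 3 / B') hB0 fun j => ?_
    have := key j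
    obtain ⟨k, hk⟩ := hk j
    rw [hk] at this ⊢
    rw [pow_succ_of_mul_self hB, pow_succ_of_mul_self hB', Matrix.trace_smul, htr] at this
    simp only [smul_eq_mul, Matrix.smul_apply] at this
    calc B ^ (k + 1) = B ^ k * B := pow_succ _ _
      _ ≤ 8 * (B' ^ k * P' 3 3) := this
      _ = _ := by rw [pow_succ]; field_simp

/-- The last diagonal entry dominates all others, so the rescaled matrices stay in a compact cube.
-/
theorem exists_subseq_tendsto (A : ℕ → SO31) :
    ∃ (P : Matrix (Fin 4) (Fin 4) ℝ) (s : ℕ → ℕ), StrictMono s ∧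
      Tendsto (fun n => (SO31.mat (A (s n)) 3 3)⁻¹ • SO31.mat (A (s n))) atTop (𝓝 P) := by
  have hK : IsCompact (Set.pi Set.univ fun _ : Fin 4 => Set.pi Set.univ fun _ : Fin 4 =>
      Set.Icc (-1 : ℝ) 1) :=
    isCompact_univ_pi fun _ => isCompact_univ_pi fun _ => isCompact_Icc
  obtain ⟨P, -, s, hs, hP⟩ := hK.tendsto_subseq
    (x := fun n => fun i j => (SO31.mat (A n) 3 3)⁻¹ * SO31.mat (A n) i j) fun n i _ j _ => by
      have h := SO31.mat_three_three_pos (A n)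
      rw [Set.mem_Icc, ← abs_le, abs_mul, abs_inv, abs_of_pos h, inv_mul_le_iff₀ h, mul_one]
      exact SO31.abs_mat_le (A n) i j
  exact ⟨P, s, hs, hP⟩

/-- The rescaled maps multiply the form by a factor tending to zero, so the image of the limit is
totally isotropic, hence at most a line in signature (3,1). The normalization keeps it nonzero. -/
theorem rank_one_of_tendsto {A : ℕ → SO31} {P : Matrix (Fin 4) (Fin 4) ℝ}
    (hA : Tendsto (fun n => SO31.mat (A n) 3 3) atTop atTop)
    (hP : Tendsto (fun n => (SO31.mat (A n) 3 3)⁻¹ • SO31.mat (A n)) atTop (𝓝 P)) :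
    ∃ a r, FutureNull a ∧ FutureNull r ∧ ∀ x, P.mulVec x = -form x r • a := by
  set c : ℕ → ℝ := fun n => (SO31.mat (A n) 3 3)⁻¹ with hc
  have hc0 : Tendsto c atTop (𝓝 0) := tendsto_inv_atTop_zero.comp hA
  have happ : ∀ n x, (c n • SO31.mat (A n)).mulVec x = c n • (A n).1 x := fun n x => by
    rw [Matrix.smul_mulVec, SO31.mat_mulVec]
  have hPP : ∀ x y, form (P.mulVec x) (P.mulVec y) = 0 := fun x y => by
    have h1 := (continuous_form.tendsto _).comp
      ((tendsto_mulVec hP x).prodMk_nhds (tendsto_mulVec hP y))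
    have h2 : Tendsto (fun n => c n * (c n * form x y)) atTop (𝓝 (0 * (0 * form x y))) :=
      hc0.mul (hc0.mul_const _)
    rw [zero_mul] at h2
    refine tendsto_nhds_unique h1 (h2.congr fun n => ?_)
    change _ = form ((c n • SO31.mat (A n)).mulVec x) ((c n • SO31.mat (A n)).mulVec y)
    rw [happ, happ, form_smul_left, form_smul_right, SO31.form_apply]
  set o : Mink := Pi.single 3 1 with ho
  set a := P.mulVec o with ha
  have ha3 : a 3 = 1 := by
    have h1 := tendsto_pi_nhds.1 (tendsto_mulVec hP o) 3
    refine tendsto_nhds_unique h1 (tendsto_const_nhds.congr fun n => ?_)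
    rw [happ, Pi.smul_apply, smul_eq_mul, ← SO31.mat_apply, hc]
    exact (inv_mul_cancel₀ (SO31.mat_three_three_pos (A n)).ne').symm
  obtain ⟨r, hr⟩ := exists_form_eq ((formₗ o).comp P.mulVecLin)
  have hr' : ∀ x, form x r = -(P.mulVec x) 3 := fun x => by
    rw [hr, ← form_single_three, form_comm]; rfl
  -- The adjoint of a Lorentz transformation is its inverse, so `r` is the rescaled limit of the
  -- inverses applied to the base vector; this makes it null.
  have hrlim : Tendsto (fun n => c n • (A n)⁻¹.1 o) atTop (𝓝 r) := by
    refine tendsto_of_form fun x => ?_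
    have h1 := tendsto_form_mulVec hP x o
    rw [form_single_three, ← hr'] at h1
    refine h1.congr fun n => ?_
    rw [happ, form_smul_left, form_smul_right, SO31.form_apply_left]
  have hrr : form r r = 0 := by
    have h1 := (continuous_form.tendsto _).comp (hrlim.prodMk_nhds hrlim)
    have h2 : Tendsto (fun n => c n * (c n * form o o)) atTop (𝓝 (0 * (0 * form o o))) :=
      hc0.mul (hc0.mul_const _)
    rw [zero_mul] at h2
    refine tendsto_nhds_unique h1 (h2.congr fun n => ?_)
    simp only [Function.comp, form_smul_left, form_smul_right, SO31.form_apply]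
  have hr3 : r 3 = 1 := by
    have := hr' o
    rw [← ha, ha3, form_comm, form_single_three] at this
    linarith
  refine ⟨a, r, ⟨hPP _ _, by rw [ha3]; norm_num⟩, ⟨hrr, by rw [hr3]; norm_num⟩, fun x => ?_⟩
  rw [hr', neg_neg]
  have := eq_smul_of_null (hPP o o) (hPP x x) (hPP o x) (by rw [← ha, ha3]; norm_num)
  rwa [← ha, ha3, div_one] at this

theorem span_singleton_smul {c : ℝ} (hc : c ≠ 0) (v : Mink) :
    Submodule.span ℝ {c • v} = Submodule.span ℝ {v} :=
  Submodule.span_singleton_smul_eq (IsUnit.mk0 c hc) v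

/-- A nonelementary discrete group contains a loxodromic element. -/
theorem Manifold.Nonelementary.exists_translationLength_pos {M : Manifold}
    (hM : M.Nonelementary) : ∃ γ : M.deck, 0 < translationLength γ.1 := by
  by_contra! h0
  refine hM ?_
  -- Bounded matrices mean bounded displacement of the base point, hence a finite group by proper
  -- discontinuity.
  by_cases hb : ∃ R : ℕ, ∀ γ : M.deck, SO31.mat γ.1 3 3 ≤ R
  · obtain ⟨R, hR⟩ := hb
    have hfin : (Set.univ : Set M.deck).Finite :=
      (M.properlyDiscontinuous H3.base (Real.log (2 * R))).subset fun γ _ => by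
        have h1 := (SO31.exp_dist_le γ.1).trans (mul_le_mul_of_nonneg_left (hR γ) zero_le_two)
        exact (Real.le_log_iff_exp_le ((Real.exp_pos _).trans_le h1)).2 h1
    have := Set.finite_univ_iff.1 hfin
    refine ⟨H3.base.1, fun h => ?_, by rw [H3.base.2.1]; norm_num, Set.finite_range _⟩
    have := H3.base.2.2
    rw [h] at this
    simp at this
  · push Not at hb
    choose A hA using hb
    obtain ⟨P, s, hs, hP⟩ := exists_subseq_tendsto fun n => (A n).1
    have hinf : Tendsto (fun n => SO31.mat (A (s n)).1 3 3) atTop atTop :=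
      tendsto_atTop_mono (fun n => (hA (s n)).le)
        (tendsto_natCast_atTop_atTop.comp hs.tendsto_atTop)
    obtain ⟨a, r, ha, hr, har⟩ := rank_one_of_tendsto hinf hP
    -- If all lengths vanish, all traces are at most 4 in absolute value, so the rescaled limit `P
    -- γ` has trace `-⟨γ a, r⟩ = 0`. Every `γ a` then lies on the line of `r`: a one-point orbit at
    -- infinity.
    have key : ∀ γ : M.deck, form (γ.1.1 a) r = 0 := fun γ => by
      have h1 := tendsto_trace (hP.mul_const (SO31.mat γ.1))
      have h2 : Tendsto (fun n => (SO31.mat (A (s n)).1 3 3)⁻¹ * 4) atTop (𝓝 0) := by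
        simpa using (tendsto_inv_atTop_zero.comp hinf).mul_const 4
      have h3 : (P * SO31.mat γ.1).trace = 0 := by
        refine tendsto_nhds_unique h1 (squeeze_zero_norm (fun n => ?_) h2)
        have hpos := inv_pos.2 (SO31.mat_three_three_pos (A (s n)).1)
        rw [Matrix.smul_mul, Matrix.trace_smul, smul_eq_mul, ← map_mul, norm_mul,
          Real.norm_eq_abs, Real.norm_eq_abs, abs_of_pos hpos]
        refine mul_le_mul_of_nonneg_left ?_ hpos.le
        have h4 := SO31.abs_trace_le ((A (s n)).1 * γ.1)
        have h5 : translationLength ((A (s n)).1 * γ.1) = 0 :=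
          le_antisymm (h0 (A (s n) * γ)) (translationLength_nonneg _)
        rwa [h5, Real.exp_zero, mul_one] at h4
      rw [trace_of_mulVec_eq (f := -((formₗ r).comp γ.1.1.toLinearMap)) (a := a)] at h3
      · have h4 : -form r (γ.1.1 a) = 0 := h3
        rw [form_comm]; linarith
      · intro x
        rw [← Matrix.mulVec_mulVec, SO31.mat_mulVec, har, form_comm]
        rfl
    refine ⟨a, ha.ne_zero, ha.null.le, (Set.finite_singleton (Submodule.span ℝ {r})).subset ?_⟩
    rintro _ ⟨γ, rfl⟩
    obtain ⟨c, hc, hcr⟩ := (ha.apply γ.1).eq_smul hr (key γ)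
    simp only [Set.mem_singleton_iff]
    rw [hcr, span_singleton_smul hc.ne']

/-! ### Loxodromic elements -/

/-- The ends of the axis of a loxodromic transformation, as null vectors. -/
structure IsAxis (g : SO31) (a r : Mink) : Prop where
  attracting : FutureNull a
  repelling : FutureNull r
  form_eq : form a r = -1
  apply_attracting : g.1 a = Real.exp (translationLength g) • a
  apply_repelling : g.1 r = Real.exp (-translationLength g) • r

/-- The projection onto the attracting end. -/
def axisProj (a r : Mink) : Matrix (Fin 4) (Fin 4) ℝ :=
  LinearMap.toMatrix' ((-formₗ r).smulRight a)

theorem axisProj_mulVec (a r x : Mink) : (axisProj a r).mulVec x = -form x r • a := by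
  rw [axisProj, LinearMap.toMatrix'_mulVec, form_comm]; rfl

theorem SO31.pow_apply_of_eq_smul {g : SO31} {a : Mink} {t : ℝ} (h : g.1 a = t • a) (n : ℕ) :
    (g ^ n).1 a = t ^ n • a := by
  induction n with
  | zero => simp
  | succ n ih => rw [pow_succ, SO31.mul_apply, h, map_smul, ih, smul_smul, pow_succ, mul_comm]

theorem SO31.inv_apply_of_eq_smul {g : SO31} {a : Mink} {t : ℝ} (ht : t ≠ 0)
    (h : g.1 a = t • a) : g⁻¹.1 a = t⁻¹ • a := by
  have := congrArg g⁻¹.1 h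
  rw [SO31.inv_apply, map_smul] at this
  rw [eq_inv_smul_iff₀ ht, ← this]

/-- Cauchy-Schwarz on the orthogonal complement of a point of hyperbolic space. -/
theorem form_sq_le {y u v : Mink} (hy : form y y = -1) (hu : form u y = 0) (hv : form v y = 0) :
    form u v ^ 2 ≤ form u u * form v v := by
  have key : ∀ t : ℝ, 0 ≤ form v v * (t * t) + (2 * form u v) * t + form u u := fun t => by
    have h := (H3.form_self_nonneg_of_orthogonal (u := u + t • v) hy (by
      rw [form_add_left, form_smul_left, hu, hv]; ring)).1
    simp only [form_add_left, form_add_right, form_smul_left, form_smul_right,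
      form_comm v u] at h
    linarith
  have := discrim_le_zero key
  rw [discrim] at this
  linarith

/-- The orthogonal complement of the plane of `a` and `r` is invariant and positive definite, so the
powers of `g` stay bounded there; after rescaling only the expanding direction survives. -/
theorem tendsto_pow_axisProj {g : SO31} {a r : Mink} {t : ℝ} (ht : 1 < t) (ha : form a a = 0)
    (hr : form r r = 0) (har : form a r = -1) (hga : g.1 a = t • a) (hgr : g.1 r = t⁻¹ • r) :
    Tendsto (fun n => (t ^ n)⁻¹ • SO31.mat (g ^ n)) atTop (𝓝 (axisProj a r)) := by
  have ht0 : t ≠ 0 := by positivity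
  have hra : form r a = -1 := by rw [form_comm, har]
  -- A unit timelike vector in the plane, which provides Cauchy-Schwarz on the complement.
  set y : Mink := (√2)⁻¹ • (a + r) with hy
  have hyy : form y y = -1 := by
    simp only [hy, form_smul_left, form_smul_right, form_add_left, form_add_right, ha, hr, har,
      hra]
    have : (√2)⁻¹ * (√2)⁻¹ = (2 : ℝ)⁻¹ := by rw [← mul_inv, Real.mul_self_sqrt zero_le_two]
    linear_combination (-2) * this
  have hys : ∀ u, form u a = 0 → form u r = 0 → form u y = 0 := fun u h1 h2 => by
    rw [hy, form_smul_right, form_add_right, h1, h2]; ring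
  have hti : Tendsto (fun n : ℕ => (t ^ n)⁻¹) atTop (𝓝 0) :=
    tendsto_inv_atTop_zero.comp (tendsto_pow_atTop_atTop_of_one_lt ht)
  have hmain : ∀ x, Tendsto (fun n => (t ^ n)⁻¹ • (g ^ n).1 x) atTop (𝓝 (-form x r • a)) := by
    intro x
    refine tendsto_of_form fun z => ?_
    -- Components orthogonal to `a` and `r`; the plus signs come from `⟨a, r⟩ = -1`.
    set w := x + form x r • a + form x a • r with hw
    set z' := z + form z r • a + form z a • r with hz'
    have hperp : ∀ x, form (x + form x r • a + form x a • r) a = 0 ∧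
        form (x + form x r • a + form x a • r) r = 0 := fun x => by
      simp only [form_add_left, form_smul_left, ha, hr, har, hra]
      constructor <;> ring
    have hwa : form w a = 0 := (hperp x).1
    have hwr : form w r = 0 := (hperp x).2
    have hgw : ∀ n, form ((g ^ n).1 w) a = 0 ∧ form ((g ^ n).1 w) r = 0 := fun n => by
      have h1 := SO31.form_apply (g ^ n) w a
      have h2 := SO31.form_apply (g ^ n) w r
      rw [SO31.pow_apply_of_eq_smul hga, form_smul_right, hwa] at h1
      rw [SO31.pow_apply_of_eq_smul hgr, form_smul_right, hwr] at h2
      exact ⟨(mul_eq_zero.1 h1).resolve_left (by positivity),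
        (mul_eq_zero.1 h2).resolve_left (by positivity)⟩
    have hexp : ∀ n, form z ((t ^ n)⁻¹ • (g ^ n).1 x) =
        -form x r * form z a - (t ^ n)⁻¹ * (t ^ n)⁻¹ * (form x a * form z r) +
          (t ^ n)⁻¹ * form ((g ^ n).1 w) z' := fun n => by
      have h1 : form ((g ^ n).1 w) z' = form z ((g ^ n).1 w) := by
        rw [hz', form_add_right, form_add_right, form_smul_right, form_smul_right, (hgw n).1,
          (hgw n).2, form_comm]
        ring
      rw [h1, hw, map_add, map_add, map_smul, map_smul, SO31.pow_apply_of_eq_smul hga,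
        SO31.pow_apply_of_eq_smul hgr]
      simp only [form_add_right, form_smul_right, inv_pow]
      have : t ^ n ≠ 0 := pow_ne_zero _ ht0
      field_simp
      ring
    have hbd : ∀ n, |form ((g ^ n).1 w) z'| ≤ √(form w w * form z' z') := fun n => by
      have := form_sq_le hyy (hys _ (hgw n).1 (hgw n).2) (hys z' (hperp z).1 (hperp z).2)
      rw [SO31.form_apply] at this
      exact Real.abs_le_sqrt this
    have h3 : Tendsto (fun n => (t ^ n)⁻¹ * form ((g ^ n).1 w) z') atTop (𝓝 0) := by
      refine squeeze_zero_norm (a := fun n => (t ^ n)⁻¹ * √(form w w * form z' z')) (fun n => ?_)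
        (by simpa using hti.mul_const _)
      rw [norm_mul, Real.norm_eq_abs, Real.norm_eq_abs, abs_of_pos (by positivity)]
      exact mul_le_mul_of_nonneg_left (hbd n) (by positivity)
    have h4 := ((((hti.mul hti).mul_const (form x a * form z r)).const_sub
      (-form x r * form z a))).add h3
    rw [form_smul_right]
    simp only [zero_mul, sub_zero, add_zero] at h4
    exact h4.congr fun n => (hexp n).symm
  refine tendsto_pi_nhds.2 fun i => tendsto_pi_nhds.2 fun j => ?_
  have := tendsto_pi_nhds.1 (hmain (Pi.single j 1)) i
  rw [← axisProj_mulVec, Matrix.mulVec_single_one] at this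
  refine this.congr fun n => ?_
  rw [Pi.smul_apply, ← SO31.mat_apply]
  rfl

theorem axisProj_trace {a r : Mink} (har : form a r = -1) : (axisProj a r).trace = 1 := by
  rw [trace_of_mulVec_eq (f := -formₗ r) (a := a)]
  · change -form r a = 1
    rw [form_comm, har, neg_neg]
  · intro x
    rw [axisProj_mulVec, form_comm]; rfl

/-- The point of the axis on `a + r` is moved by exactly `log t`. Conversely, the trace of `t ^ (-n)
g ^ n` tends to 1 but is at most `4 (e^ℓ / t) ^ n`, which would tend to 0 if `e^ℓ < t`. -/
theorem translationLength_eq_log {g : SO31} {a r : Mink} {t : ℝ} (ht : 1 < t)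
    (ha : FutureNull a) (hr : FutureNull r) (har : form a r = -1) (hga : g.1 a = t • a)
    (hgr : g.1 r = t⁻¹ • r) : translationLength g = Real.log t := by
  have ht0 : 0 < t := by positivity
  apply le_antisymm
  · have hra : form r a = -1 := by rw [form_comm, har]
    have hv : form (a + r) (a + r) = -2 := by
      simp only [form_add_left, form_add_right, ha.null, hr.null, har, hra]; norm_num
    have h2 := cosh_dist_normalize g (a + r) (by rw [hv]; norm_num) (add_pos ha.pos hr.pos)
    have h1 := translationLength_le g
      (H3.normalize (a + r) (by rw [hv]; norm_num) (add_pos ha.pos hr.pos))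
    refine h1.trans ?_
    have h3 : Real.cosh (Real.log t) = (t + t⁻¹) / 2 := Real.cosh_log ht0
    have h4 : form (a + r) (g.1 (a + r)) / form (a + r) (a + r) = (t + t⁻¹) / 2 := by
      rw [hv, map_add, hga, hgr]
      simp only [form_add_left, form_add_right, form_smul_right, ha.null, hr.null, har, hra]
      ring
    rw [h4, ← h3] at h2
    have h5 := h2.le
    rwa [Real.cosh_le_cosh, abs_of_nonneg dist_nonneg, abs_of_pos (Real.log_pos ht)] at h5
  · rw [Real.log_le_iff_le_exp ht0]
    have h1 := tendsto_trace (tendsto_pow_axisProj ht ha.null hr.null har hga hgr)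
    rw [axisProj_trace har] at h1
    have h2 : ∀ n : ℕ, (t ^ n)⁻¹ * (SO31.mat (g ^ n)).trace ≤
        4 * (Real.exp (translationLength g) / t) ^ n := fun n => by
      rw [div_pow, ← Real.exp_nat_mul, inv_mul_eq_div, ← mul_div_assoc]
      refine div_le_div_of_nonneg_right ?_ (by positivity)
      refine (le_abs_self _).trans ((SO31.abs_trace_le _).trans ?_)
      have := Real.exp_le_exp.2 (translationLength_pow_le g n)
      linarith
    by_contra! hlt
    have h3 : Tendsto (fun n : ℕ => 4 * (Real.exp (translationLength g) / t) ^ n) atTop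
        (𝓝 (4 * 0)) :=
      (tendsto_pow_atTop_nhds_zero_of_lt_one (by positivity) ((div_lt_one ht0).2 hlt)).const_mul 4
    have h4 := le_of_tendsto_of_tendsto' h1 h3 fun n => by
      rw [Matrix.trace_smul, smul_eq_mul]
      exact h2 n
    linarith

/-- Along the geodesic ray from the base point towards `a`, given by the vectors `o + n a`, the
displacement tends to zero. -/
theorem translationLength_eq_zero_of_fixed {g : SO31} {a : Mink} (ha : FutureNull a)
    (hga : g.1 a = a) : translationLength g = 0 := by
  refine le_antisymm ?_ (translationLength_nonneg g)
  set o := H3.base with ho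
  set p := form o.1 a with hp
  have hp0 : p < 0 := ha.form_neg o
  have hpg : form a (g.1 o.1) = p := by
    conv_lhs => rw [← hga]
    rw [SO31.form_apply, form_comm]
  set q := form o.1 (g.1 o.1) with hq
  have hlim : Tendsto (fun n : ℕ => (q + 2 * p * n) / (-1 + 2 * p * n)) atTop (𝓝 1) := by
    have h1 : Tendsto (fun n : ℕ => (-1 + 2 * p * n : ℝ)) atTop atBot :=
      tendsto_atBot_add_const_left _ _
        ((tendsto_natCast_atTop_atTop).const_mul_atTop_of_neg (by linarith))
    have h2 : Tendsto (fun n : ℕ => 1 + (q + 1) * (-1 + 2 * p * n : ℝ)⁻¹) atTop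
        (𝓝 (1 + (q + 1) * 0)) :=
      ((tendsto_inv_atBot_zero.comp h1).const_mul (q + 1)).const_add 1
    rw [mul_zero, add_zero] at h2
    refine h2.congr fun n => ?_
    have : (-1 + 2 * p * n : ℝ) ≠ 0 := by
      have : p * n ≤ 0 := mul_nonpos_of_nonpos_of_nonneg hp0.le n.cast_nonneg
      linarith
    field_simp
    ring
  have hle : ∀ n : ℕ, Real.cosh (translationLength g) ≤ (q + 2 * p * n) / (-1 + 2 * p * n) :=
    fun n => by
      have hv : form (o.1 + (n : ℝ) • a) (o.1 + (n : ℝ) • a) = -1 + 2 * p * n := by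
        simp only [form_add_left, form_add_right, form_smul_left, form_smul_right, ha.null,
          o.2.1, form_comm a o.1, ← hp]
        ring
      have hv0 : form (o.1 + (n : ℝ) • a) (o.1 + (n : ℝ) • a) < 0 := by
        have : p * n ≤ 0 := mul_nonpos_of_nonpos_of_nonneg hp0.le n.cast_nonneg
        rw [hv]; linarith
      have hv3 : 0 < (o.1 + (n : ℝ) • a) 3 := by
        have := mul_nonneg (n.cast_nonneg (α := ℝ)) ha.pos.le
        exact add_pos_of_pos_of_nonneg o.2.2 this
      have h1 := translationLength_le g (H3.normalize _ hv0 hv3)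
      have h2 := cosh_dist_normalize g _ hv0 hv3
      have h3 : form (o.1 + (n : ℝ) • a) (g.1 (o.1 + (n : ℝ) • a)) = q + 2 * p * n := by
        simp only [map_add, map_smul, hga, form_add_left, form_add_right, form_smul_left,
          form_smul_right, ha.null, hpg, ← hp, ← hq]
        ring
      rw [hv, h3] at h2
      rw [← h2, Real.cosh_le_cosh, abs_of_nonneg (translationLength_nonneg g),
        abs_of_nonneg dist_nonneg]
      exact h1
  have h1 := ge_of_tendsto' hlim hle
  rw [← Real.cosh_zero, Real.cosh_le_cosh, abs_zero] at h1
  exact (le_abs_self _).trans h1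

/-- An isometry of positive translation length has an axis. -/
theorem exists_isAxis {g : SO31} (hg : 0 < translationLength g) : ∃ a r, IsAxis g a r := by
  -- Length at least doubles under squaring, so these powers leave every bounded set.
  have hinf : Tendsto (fun j : ℕ => SO31.mat (g ^ 2 ^ j) 3 3) atTop atTop := by
    have h1 : Tendsto (fun j : ℕ => (2 : ℝ) ^ j * translationLength g) atTop atTop :=
      (tendsto_pow_atTop_atTop_of_one_lt one_lt_two).atTop_mul_const hg
    refine tendsto_atTop_mono (fun j => ?_) (h1.atTop_mul_const (by norm_num : (0 : ℝ) < 1 / 2))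
    have h2 := two_pow_mul_translationLength_le g j
    have h3 := translationLength_le (g ^ 2 ^ j) H3.base
    have h4 := SO31.exp_dist_le (g ^ 2 ^ j)
    have h5 := Real.add_one_le_exp (dist H3.base (g ^ 2 ^ j • H3.base))
    linarith
  obtain ⟨P, s, hs, hP⟩ := exists_subseq_tendsto fun j => g ^ 2 ^ j
  obtain ⟨a, r, ha, hr, har⟩ := rank_one_of_tendsto (hinf.comp hs.tendsto_atTop) hP
  -- As a limit of rescaled powers of `g`, the map `P` commutes with `g`. Its image, spanned by `a`,
  -- and its kernel, orthogonal to `r`, are thus invariant, so `a` and `r` are eigenvectors.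
  have hcomm : ∀ x, P.mulVec (g.1 x) = g.1 (P.mulVec x) := fun x => by
    have h1 : SO31.mat g * P = P * SO31.mat g := by
      refine tendsto_nhds_unique (hP.const_mul (SO31.mat g))
        ((hP.mul_const (SO31.mat g)).congr fun n => ?_)
      rw [Matrix.smul_mul, Matrix.mul_smul, ← map_mul, ← map_mul, ← pow_succ, ← pow_succ']
    rw [← SO31.mat_mulVec g, ← SO31.mat_mulVec g, Matrix.mulVec_mulVec, Matrix.mulVec_mulVec, h1]
  have hPx : ∀ x, form (g.1 x) r • a = form x r • g.1 a := fun x => by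
    have := hcomm x
    rw [har, har, map_smul] at this
    simpa using this
  have hro : form H3.base.1 r ≠ 0 := (hr.form_neg H3.base).ne
  obtain ⟨t, ht, hga⟩ : ∃ t : ℝ, 0 < t ∧ g.1 a = t • a := by
    refine ⟨form (g.1 H3.base.1) r / form H3.base.1 r,
      div_pos_of_neg_of_neg (hr.form_neg (g • H3.base)) (hr.form_neg _), ?_⟩
    rw [div_eq_inv_mul, mul_smul, hPx, smul_smul, inv_mul_cancel₀ hro, one_smul]
  have hgr' : g⁻¹.1 r = t • r := by
    refine ext_form fun x => ?_
    rw [form_comm, ← SO31.form_apply_left, form_smul_left]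
    have h1 := hPx x
    rw [hga, smul_smul] at h1
    rw [smul_left_injective ℝ ha.ne_zero h1, form_comm x r, mul_comm]
  have hgr : g.1 r = t⁻¹ • r := by
    have := SO31.inv_apply_of_eq_smul ht.ne' hgr'
    rwa [inv_inv] at this
  -- Proportional ends would give `t = t⁻¹`, so a fixed null vector and zero length.
  have hne : form a r ≠ 0 := fun h => by
    obtain ⟨c, hc, hcr⟩ := ha.eq_smul hr h
    rw [hcr, map_smul, hga, smul_comm] at hgr
    have h1 := smul_left_injective ℝ (ha.smul hc).ne_zero hgr
    have h2 : t = 1 := by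
      have : t * t = 1 := by
        nth_rewrite 1 [show t = t⁻¹ from h1]
        exact inv_mul_cancel₀ ht.ne'
      nlinarith
    rw [h2, one_smul] at hga
    exact hg.ne' (translationLength_eq_zero_of_fixed ha hga)
  have hneg : form a r < 0 := lt_of_le_of_ne (ha.form_nonpos hr) hne
  set r' := (-form a r)⁻¹ • r with hr'
  have hr'n : FutureNull r' := hr.smul (inv_pos.2 (by linarith))
  have har' : form a r' = -1 := by
    rw [hr', form_smul_right, inv_neg, neg_mul, inv_mul_cancel₀ hne]
  have hgr'' : g.1 r' = t⁻¹ • r' := by rw [hr', map_smul, hgr, smul_comm]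
  -- The limit does not tell which eigenvector expands; for `t < 1` the two ends exchange roles.
  rcases lt_trichotomy t 1 with h | h | h
  · have hra' : form r' a = -1 := by rw [form_comm, har']
    have hl := translationLength_eq_log ((one_lt_inv₀ ht).2 h) hr'n ha hra' hgr''
      (by rw [inv_inv, hga])
    refine ⟨r', a, hr'n, ha, hra', ?_, ?_⟩
    · rw [hl, Real.exp_log (inv_pos.2 ht), hgr'']
    · rw [hl, Real.exp_neg, Real.exp_log (inv_pos.2 ht), inv_inv, hga]
  · rw [h, one_smul] at hga
    exact absurd (translationLength_eq_zero_of_fixed ha hga) hg.ne'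
  · have hl := translationLength_eq_log h ha hr'n har' hga hgr''
    refine ⟨a, r', ha, hr'n, har', ?_, ?_⟩
    · rw [hl, Real.exp_log ht, hga]
    · rw [hl, Real.exp_neg, Real.exp_log ht, hgr'']

theorem IsAxis.tendsto {g : SO31} {a r : Mink} (h : IsAxis g a r) (hg : 0 < translationLength g) :
    Tendsto (fun n => (Real.exp (translationLength g) ^ n)⁻¹ • SO31.mat (g ^ n)) atTop
      (𝓝 (axisProj a r)) :=
  tendsto_pow_axisProj (Real.one_lt_exp_iff.2 hg) h.attracting.null h.repelling.null h.form_eq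
    h.apply_attracting (by rw [← Real.exp_neg, h.apply_repelling])

theorem translationLength_inv (g : SO31) : translationLength g⁻¹ = translationLength g :=
  iInf_congr fun x => by
    rw [← dist_smul_smul g, smul_inv_smul, dist_comm]

theorem IsAxis.inv {g : SO31} {a r : Mink} (h : IsAxis g a r) : IsAxis g⁻¹ r a where
  attracting := h.repelling
  repelling := h.attracting
  form_eq := by rw [form_comm, h.form_eq]
  apply_attracting := by
    rw [translationLength_inv, SO31.inv_apply_of_eq_smul (Real.exp_pos _).ne' h.apply_repelling,
      ← Real.exp_neg, neg_neg]
  apply_repelling := by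
    rw [translationLength_inv, SO31.inv_apply_of_eq_smul (Real.exp_pos _).ne' h.apply_attracting,
      ← Real.exp_neg]

/-- The translation lengths of `g ^ n * γ` determine the pairing of the ends of the axis of `g`. -/
theorem IsAxis.neg_form_le {g g' γ γ' : SO31} {a r a' r' : Mink} (h : IsAxis g a r)
    (h' : IsAxis g' a' r') (hg : 0 < translationLength g)
    (hgg' : translationLength g' = translationLength g)
    (hl : ∀ n : ℕ, translationLength (g ^ n * γ) ≤ translationLength (g' ^ n * γ')) :
    -form (γ.1 a) r ≤ -form (γ'.1 a') r' := by
  have hlim := (h.tendsto hg).mul_const (SO31.mat γ)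
  have hlim' := (h'.tendsto (hgg'.symm ▸ hg)).mul_const (SO31.mat γ')
  simp only [Matrix.smul_mul, ← map_mul] at hlim hlim'
  rw [hgg'] at hlim'
  -- The limit of the rescaled `g ^ n δ` is the rank one map `x ↦ -⟨δ x, s⟩ b`, with trace `-⟨δ b,
  -- s⟩`.
  have hmul : ∀ (δ : SO31) (b s : Mink) (x : Mink), (axisProj b s * SO31.mat δ).mulVec x =
      (-((formₗ s).comp δ.1.toLinearMap)) x • b := fun δ b s x => by
    rw [← Matrix.mulVec_mulVec, SO31.mat_mulVec, axisProj_mulVec, form_comm]; rfl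
  have key := le_of_translationLength_le (fun n => by positivity) hlim hlim' hl
    (mul_self_of_mulVec_eq (hmul γ a r)) (mul_self_of_mulVec_eq (hmul γ' a' r'))
    (trace_of_mulVec_eq (hmul γ a r)) (by
      change 0 ≤ -form r' (γ'.1 a')
      linarith [h'.repelling.form_nonpos (h'.attracting.apply γ')])
  have key' : -form r (γ.1 a) ≤ -form r' (γ'.1 a') := key
  rwa [form_comm r, form_comm r'] at key'

/-! ### The span of an orbit of null vectors -/

namespace Manifold

variable (M N : Manifold)

/-- The linear span of the orbit of a vector. -/
def orbitSpan (a : Mink) : Submodule ℝ Mink :=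
  Submodule.span ℝ (Set.range fun γ : M.deck => γ.1.1 a)

variable {M N} {a r a' r' : Mink}

theorem apply_mem_orbitSpan (γ : M.deck) : γ.1.1 a ∈ M.orbitSpan a :=
  Submodule.subset_span ⟨γ, rfl⟩

theorem self_mem_orbitSpan : a ∈ M.orbitSpan a :=
  apply_mem_orbitSpan (1 : M.deck)

theorem orbitSpan_le {W : Submodule ℝ Mink} (h : ∀ γ : M.deck, γ.1.1 a ∈ W) :
    M.orbitSpan a ≤ W :=
  Submodule.span_le.2 (by rintro _ ⟨γ, rfl⟩; exact h γ)

theorem apply_mem_of_mem_orbitSpan (γ : M.deck) {x : Mink} (hx : x ∈ M.orbitSpan a) :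
    γ.1.1 x ∈ M.orbitSpan a := by
  have : M.orbitSpan a ≤ (M.orbitSpan a).comap γ.1.1.toLinearMap :=
    orbitSpan_le fun δ => apply_mem_orbitSpan (γ * δ)
  exact this hx

theorem orbitSpan_eq_of_mem (h : r ∈ M.orbitSpan a) (h' : a ∈ M.orbitSpan r) :
    M.orbitSpan a = M.orbitSpan r :=
  le_antisymm (orbitSpan_le fun γ => apply_mem_of_mem_orbitSpan γ h')
    (orbitSpan_le fun γ => apply_mem_of_mem_orbitSpan γ h)

/-- The limit set of a nonelementary group has at least three points. -/
theorem Nonelementary.exists_form_ne (hM : M.Nonelementary) (ha : FutureNull a)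
    (hr : FutureNull r) : ∃ γ : M.deck, form (γ.1.1 a) a ≠ 0 ∧ form (γ.1.1 a) r ≠ 0 := by
  by_contra! h
  refine hM ⟨a, ha.ne_zero, ha.null.le, Set.Finite.subset
    (s := {Submodule.span ℝ {a}, Submodule.span ℝ {r}}) (Set.toFinite _) ?_⟩
  rintro _ ⟨γ, rfl⟩
  simp only [Set.mem_insert_iff, Set.mem_singleton_iff]
  by_cases h0 : form (γ.1.1 a) a = 0
  · obtain ⟨c, hc, hcr⟩ := ha.eq_smul (ha.apply γ.1) (by rwa [form_comm])
    left
    rw [hcr, span_singleton_smul hc.ne']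
  · obtain ⟨c, hc, hcr⟩ := hr.eq_smul (ha.apply γ.1) (by rw [form_comm, h γ h0])
    right
    rw [hcr, span_singleton_smul hc.ne']

/-- Rescaled, `g ^ (-n) γ a` tends to `-⟨γ a, a⟩ r`. Some `γ` makes the coefficient nonzero, and
finite dimensional subspaces are closed. -/
theorem Nonelementary.repelling_mem (hM : M.Nonelementary) {g : M.deck} (h : IsAxis g.1 a r)
    (hg : 0 < translationLength g.1) : r ∈ M.orbitSpan a := by
  obtain ⟨γ, hγ, -⟩ := hM.exists_form_ne h.attracting h.attracting
  have h1 := tendsto_mulVec (h.inv.tendsto (by rwa [translationLength_inv])) (γ.1.1 a)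
  have hclosed : IsClosed (M.orbitSpan a : Set Mink) :=
    Submodule.closed_of_finiteDimensional _
  have h2 : (axisProj r a).mulVec (γ.1.1 a) ∈ M.orbitSpan a := by
    refine hclosed.mem_of_tendsto h1 (Eventually.of_forall fun n => ?_)
    rw [Matrix.smul_mulVec, SO31.mat_mulVec]
    exact Submodule.smul_mem _ _ (apply_mem_orbitSpan (g⁻¹ ^ n * γ))
  rw [axisProj_mulVec] at h2
  have h3 := Submodule.smul_mem _ (-form (γ.1.1 a) a)⁻¹ h2
  rwa [smul_smul, inv_mul_cancel₀ (neg_ne_zero.2 hγ), one_smul] at h3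

theorem Nonelementary.orbitSpan_eq (hM : M.Nonelementary) {g : M.deck} (h : IsAxis g.1 a r)
    (hg : 0 < translationLength g.1) : M.orbitSpan a = M.orbitSpan r :=
  orbitSpan_eq_of_mem (hM.repelling_mem h hg)
    (hM.repelling_mem (g := g⁻¹) h.inv (by
      change 0 < translationLength (g.1)⁻¹
      rwa [translationLength_inv]))

end Manifold

/-! ### Subspaces containing a timelike vector -/

/-- A unit timelike vector in the plane of two null vectors. -/
theorem exists_timelike {a r : Mink} (ha : form a a = 0) (hr : form r r = 0)
    (har : form a r = -1) {W : Submodule ℝ Mink} (haW : a ∈ W) (hrW : r ∈ W) :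
    ∃ y ∈ W, form y y = -1 := by
  refine ⟨(√2)⁻¹ • (a + r), W.smul_mem _ (W.add_mem haW hrW), ?_⟩
  simp only [form_smul_left, form_smul_right, form_add_left, form_add_right, ha, hr, har,
    form_comm r a]
  have : (√2)⁻¹ * (√2)⁻¹ = (2 : ℝ)⁻¹ := by rw [← mul_inv, Real.mul_self_sqrt zero_le_two]
  linear_combination (-2) * this

/-- The complement of a timelike vector is positive definite, so a null vector in it vanishes. This
is nondegeneracy of the form on the orbit spans. -/
theorem eq_zero_of_orthogonal {W : Submodule ℝ Mink} {y u : Mink} (hyW : y ∈ W)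
    (hy : form y y = -1) (hu : u ∈ W) (h : ∀ v ∈ W, form u v = 0) : u = 0 :=
  (H3.form_self_nonneg_of_orthogonal hy (h y hyW)).2 (h u hu)

theorem exists_unit_normal {W : Submodule ℝ Mink} (hW : W ≠ ⊤) {y : Mink} (hyW : y ∈ W)
    (hy : form y y = -1) : ∃ n, form n n = 1 ∧ ∀ v ∈ W, form v n = 0 := by
  obtain ⟨f, hf, hWf⟩ := W.exists_le_ker_of_lt_top hW.lt_top
  obtain ⟨m, hm⟩ := exists_form_eq f
  have hmW : ∀ v ∈ W, form v m = 0 := fun v hv => by rw [hm]; exact hWf hv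
  have hpos : 0 < form m m := by
    have h := H3.form_self_nonneg_of_orthogonal (u := m) hy (by rw [form_comm, hmW y hyW])
    refine lt_of_le_of_ne h.1 fun h0 => hf (LinearMap.ext fun x => ?_)
    rw [← hm, h.2 h0.symm, form_zero_right]; rfl
  refine ⟨(√(form m m))⁻¹ • m, ?_, fun v hv => by rw [form_smul_right, hmW v hv, mul_zero]⟩
  rw [form_smul_left, form_smul_right, ← mul_assoc, ← mul_inv, Real.mul_self_sqrt hpos.le,
    inv_mul_cancel₀ hpos.ne']

theorem exists_comp_eq_of_ker_le {V : Type*} [AddCommGroup V] [Module ℝ V]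
    (T S : V →ₗ[ℝ] Mink) (h : LinearMap.ker T ≤ LinearMap.ker S) :
    ∃ F : Mink →ₗ[ℝ] Mink, ∀ x, F (T x) = S x := by
  obtain ⟨F, hF⟩ := LinearMap.exists_extend
    (((LinearMap.ker T).liftQ S h).comp T.quotKerEquivRange.symm.toLinearMap)
  refine ⟨F, fun x => ?_⟩
  have := LinearMap.congr_fun hF ⟨T x, LinearMap.mem_range_self T x⟩
  rw [LinearMap.comp_apply] at this
  refine this.trans ?_
  exact congrArg ((LinearMap.ker T).liftQ S h)
    (LinearMap.quotKerEquivRange_symm_apply_image T x (LinearMap.mem_range_self T x))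

/-! ### The conjugating map -/

section Conjugation

variable {M N : Manifold} {φ : M.deck ≃* N.deck} {g : M.deck} {a r a' r' : Mink}

/-- Equality of the pairings of orbits of null vectors yields an equivariant linear map between
the spans of the orbits, which preserves the Lorentz form. -/
theorem exists_equivariant_on_span (hM : M.Nonelementary) (hN : N.Nonelementary)
    (hg : 0 < translationLength g.1) (hg' : translationLength (φ g).1 = translationLength g.1)
    (h : IsAxis g.1 a r) (h' : IsAxis (φ g).1 a' r')
    (hform : ∀ γ : M.deck, form ((φ γ).1.1 a') r' = form (γ.1.1 a) r) :
    ∃ F : Mink →ₗ[ℝ] Mink, (∀ γ : M.deck, ∀ x ∈ M.orbitSpan a, F (γ.1.1 x) = (φ γ).1.1 (F x)) ∧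
      (∀ x ∈ M.orbitSpan a, ∀ y ∈ M.orbitSpan a, form (F x) (F y) = form x y) ∧
      FutureNull (F a) := by
  have hg0' : 0 < translationLength (φ g).1 := hg'.symm ▸ hg
  -- Invariance of the form reduces this to `hform` at `δ⁻¹ * γ`.
  have hpair : ∀ γ δ : M.deck, form ((φ γ).1.1 a') ((φ δ).1.1 r') = form (γ.1.1 a) (δ.1.1 r) :=
    fun γ δ => by
      have h1 := hform (δ⁻¹ * γ)
      rw [map_mul, map_inv] at h1
      change form ((φ δ).1⁻¹.1 ((φ γ).1.1 a')) r' = form (δ.1⁻¹.1 (γ.1.1 a)) r at h1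
      rwa [← SO31.form_apply (φ δ).1, SO31.apply_inv, ← SO31.form_apply δ.1 (δ.1⁻¹.1 _),
        SO31.apply_inv] at h1
  have hV := hM.orbitSpan_eq h hg
  have hV' := hN.orbitSpan_eq h' hg0'
  have hrV : r ∈ M.orbitSpan a := hM.repelling_mem h hg
  obtain ⟨y, hyV, hy⟩ := exists_timelike h.attracting.null h.repelling.null h.form_eq
    (Manifold.self_mem_orbitSpan (M := M)) hrV
  obtain ⟨y', hyV', hy'⟩ := exists_timelike h'.attracting.null h'.repelling.null h'.form_eq
    (Manifold.self_mem_orbitSpan (M := N)) (hN.repelling_mem h' hg0')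
  -- Formal combinations of group elements: `T` and `S` evaluate them on the two orbits, and the map
  -- sought exists once each relation for `T` is one for `S`. Relations transfer because pairing
  -- with the orbit of `r'` detects zero in the target span.
  set T := Finsupp.linearCombination ℝ fun γ : M.deck => γ.1.1 a with hT
  set S := Finsupp.linearCombination ℝ fun γ : M.deck => (φ γ).1.1 a' with hS
  have hTS : ∀ c, ∀ δ : M.deck, form (S c) ((φ δ).1.1 r') = form (T c) (δ.1.1 r) := fun c δ => by
    have : (formₗ.flip ((φ δ).1.1 r')).comp S = (formₗ.flip (δ.1.1 r)).comp T := by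
      refine Finsupp.lhom_ext fun γ t => ?_
      simp only [LinearMap.comp_apply, LinearMap.flip_apply, hT, hS,
        Finsupp.linearCombination_single, map_smul, formₗ_apply, hpair]
    exact LinearMap.congr_fun this c
  have hSV' : ∀ c, S c ∈ N.orbitSpan a' := fun c => by
    have h1 : S c ∈ LinearMap.range S := LinearMap.mem_range_self S c
    rw [hS, Finsupp.range_linearCombination] at h1
    refine Submodule.span_mono ?_ h1
    rintro _ ⟨γ, rfl⟩
    exact ⟨φ γ, rfl⟩
  have hnondeg' : ∀ u ∈ N.orbitSpan a', (∀ δ : N.deck, form u (δ.1.1 r') = 0) → u = 0 := by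
    intro u hu hδ
    refine eq_zero_of_orthogonal hyV' hy' hu fun v hv => ?_
    rw [hV'] at hv
    exact Manifold.orbitSpan_le (W := LinearMap.ker (formₗ u)) hδ hv
  obtain ⟨F, hF⟩ := exists_comp_eq_of_ker_le T S fun c hc => by
    rw [LinearMap.mem_ker] at hc ⊢
    refine hnondeg' _ (hSV' c) fun δ => ?_
    obtain ⟨δ, rfl⟩ := φ.surjective δ
    rw [hTS, hc, form_zero_left]
  have hFγ : ∀ γ : M.deck, F (γ.1.1 a) = (φ γ).1.1 a' := fun γ => by
    have := hF (Finsupp.single γ 1)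
    simpa [hT, hS] using this
  have hFa : F a = a' := by
    have := hFγ 1
    rw [map_one] at this
    exact this
  have hequiv : ∀ γ : M.deck, ∀ x ∈ M.orbitSpan a, F (γ.1.1 x) = (φ γ).1.1 (F x) :=
    fun γ x hx => by
      have : M.orbitSpan a ≤ LinearMap.eqLocus (F.comp γ.1.1.toLinearMap)
          ((φ γ).1.1.toLinearMap.comp F) :=
        Manifold.orbitSpan_le fun δ => by
          change F (γ.1.1 (δ.1.1 a)) = (φ γ).1.1 (F (δ.1.1 a))
          rw [hFγ δ]
          have := hFγ (γ * δ)
          rw [map_mul] at this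
          exact this
      exact this hx
  have hFr' : ∀ x ∈ M.orbitSpan a, ∀ δ : M.deck,
      form (F x) ((φ δ).1.1 r') = form x (δ.1.1 r) := fun x hx δ => by
    have : M.orbitSpan a ≤ LinearMap.eqLocus ((formₗ.flip ((φ δ).1.1 r')).comp F)
        (formₗ.flip (δ.1.1 r)) :=
      Manifold.orbitSpan_le fun γ => by
        change form (F (γ.1.1 a)) _ = form (γ.1.1 a) _
        rw [hFγ, hpair]
    exact this hx
  -- `F r` is contracted by `φ g` at the rate of `r'`, so its rescaled images under powers of the
  -- inverse are constant; they also converge to a multiple of `r'`.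
  obtain ⟨κ, hκ⟩ : ∃ κ : ℝ, F r = κ • r' := by
    have h1 : (φ g).1.1 (F r) = Real.exp (-translationLength (φ g).1) • F r := by
      rw [← hequiv g r hrV, h.apply_repelling, map_smul, hg']
    have h2 := SO31.inv_apply_of_eq_smul (Real.exp_pos _).ne' h1
    rw [← Real.exp_neg, neg_neg] at h2
    have h3 := tendsto_mulVec (h'.inv.tendsto (by rwa [translationLength_inv])) (F r)
    refine ⟨-form (F r) a', ?_⟩
    rw [axisProj_mulVec] at h3
    refine tendsto_nhds_unique (tendsto_const_nhds.congr fun n => ?_) h3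
    rw [Matrix.smul_mulVec, SO31.mat_mulVec, SO31.pow_apply_of_eq_smul h2, smul_smul,
      translationLength_inv, inv_mul_cancel₀ (by positivity), one_smul]
  have hFF : ∀ x ∈ M.orbitSpan a, ∀ y ∈ M.orbitSpan a, form (F x) (F y) = κ * form x y := by
    intro x hx y hy
    have : M.orbitSpan r ≤ LinearMap.eqLocus ((formₗ (F x)).comp F) (κ • formₗ x) :=
      Manifold.orbitSpan_le fun δ => by
        change form (F x) (F (δ.1.1 r)) = κ * form x (δ.1.1 r)
        rw [hequiv δ r hrV, hκ, map_smul, form_smul_right, hFr' x hx]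
    rw [hV] at hy
    exact this hy
  have hκ0 : κ ≠ 0 := fun h0 => by
    rw [h0, zero_smul] at hκ
    have h1 := hFr' r hrV
    refine h.repelling.ne_zero (eq_zero_of_orthogonal hyV hy hrV fun v hv => ?_)
    rw [hV] at hv
    refine Manifold.orbitSpan_le (W := LinearMap.ker (formₗ r)) (fun δ => ?_) hv
    change form r (δ.1.1 r) = 0
    rw [← h1, hκ, form_zero_left]
  -- Products of future null vectors are nonpositive on both sides, so a nonzero `⟨γ a, a⟩` fixes
  -- the sign.
  have hκpos : 0 < κ := by
    obtain ⟨γ, hγ, -⟩ := hM.exists_form_ne h.attracting h.attracting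
    have h1 := hFF _ (Manifold.apply_mem_orbitSpan γ) a Manifold.self_mem_orbitSpan
    rw [hFγ, hFa] at h1
    have h2 := (h'.attracting.apply (φ γ).1).form_nonpos h'.attracting
    have h3 := lt_of_le_of_ne ((h.attracting.apply γ.1).form_nonpos h.attracting) hγ
    refine lt_of_le_of_ne (le_of_not_gt fun hneg => ?_) (Ne.symm hκ0)
    have := mul_pos_of_neg_of_neg hneg h3
    linarith
  have hs : (√κ)⁻¹ * ((√κ)⁻¹ * κ) = 1 := by
    rw [← mul_assoc, ← mul_inv, Real.mul_self_sqrt hκpos.le, inv_mul_cancel₀ hκ0]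
  -- The condition `⟨a, r⟩ = -1` leaves the scale of `a` against `r` free, so `κ` need not be 1 and
  -- is normalized here.
  refine ⟨(√κ)⁻¹ • F, fun γ x hx => ?_, fun x hx y hy => ?_, ?_⟩
  · rw [LinearMap.smul_apply, LinearMap.smul_apply, hequiv γ x hx, map_smul]
  · rw [LinearMap.smul_apply, LinearMap.smul_apply, form_smul_left, form_smul_right,
      hFF x hx y hy]
    linear_combination form x y * hs
  · rw [LinearMap.smul_apply, hFa]
    exact h'.attracting.smul (inv_pos.2 (Real.sqrt_pos.2 hκpos))

theorem injective_of_form_eq {F : Mink →ₗ[ℝ] Mink} (hF : ∀ x y, form (F x) (F y) = form x y) :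
    Function.Injective F :=
  (injective_iff_map_eq_zero F).2 fun x hx => eq_zero_of_form_eq_zero fun y => by
    rw [← hF, hx, form_zero_left]

/-- Three null vectors with pairwise nonzero products are independent: `a`, `r` and a suitable `γ
a`. -/
theorem three_le_finrank_orbitSpan (hM : M.Nonelementary) (hg : 0 < translationLength g.1)
    (h : IsAxis g.1 a r) : 3 ≤ Module.finrank ℝ (M.orbitSpan a) := by
  obtain ⟨γ, hγa, hγr⟩ := hM.exists_form_ne h.attracting h.repelling
  set b := γ.1.1 a with hb
  have hbb : form b b = 0 := (h.attracting.apply γ.1).null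
  have hind : LinearIndependent ℝ ![a, r, b] := by
    refine Fintype.linearIndependent_iff.2 fun c hc => ?_
    rw [Fin.sum_univ_three] at hc
    simp only [Matrix.cons_val_zero, Matrix.cons_val_one, Matrix.cons_val] at hc
    have hf : ∀ z, c 0 * form a z + c 1 * form r z + c 2 * form b z = 0 := fun z => by
      rw [← form_smul_left, ← form_smul_left, ← form_smul_left, ← form_add_left,
        ← form_add_left, hc, form_zero_left]
    have ea := hf a
    have er := hf r
    have eb := hf b
    rw [h.attracting.null, form_comm r a, h.form_eq] at ea
    rw [h.repelling.null, h.form_eq] at er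
    rw [hbb, form_comm a b, form_comm r b] at eb
    have h2 : c 2 = 0 := by
      have : c 2 * (form b a * form b r) = 0 := by
        linear_combination (form b r / 2) * ea + (form b a / 2) * er + (1 / 2) * eb
      exact (mul_eq_zero.1 this).resolve_right (mul_ne_zero hγa hγr)
    rw [h2] at ea er
    intro i
    fin_cases i
    · change c 0 = 0
      linarith
    · change c 1 = 0
      linarith
    · exact h2
  have h1 := finrank_span_eq_card hind
  rw [Fintype.card_fin] at h1
  refine h1.ge.trans (Submodule.finrank_mono (Submodule.span_le.2 ?_))
  rintro _ ⟨i, rfl⟩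
  fin_cases i
  · exact Manifold.self_mem_orbitSpan
  · exact hM.repelling_mem h hg
  · exact Manifold.apply_mem_orbitSpan γ

/-- A determinant one linear isometry that fixes a nondegenerate hyperplane is the identity. -/
theorem eq_one_of_fixes_hyperplane {C : Mink ≃ₗ[ℝ] Mink}
    (hC : ∀ x y, form (C x) (C y) = form x y) (hdet : LinearEquiv.det C = 1) {n : Mink}
    (hn : form n n = 1) (hfix : ∀ x, form x n = 0 → C x = x) : C = 1 := by
  set ε := form (C n) n with hε
  have hdec : ∀ x, form (x - form x n • n) n = 0 := fun x => by
    rw [form_sub_left, form_smul_left, hn]; ring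
  have hCn : C n = ε • n := by
    refine ext_form fun z => ?_
    have h1 : form (C n) (z - form z n • n) = 0 := by
      rw [← hfix _ (hdec z), hC, form_comm, hdec]
    rw [form_sub_right, form_smul_right, ← hε] at h1
    rw [form_smul_left, form_comm n z]
    linarith
  have hCx : ∀ x, C x = x + form n x • (ε - 1) • n := fun x => by
    have h1 := hfix _ (hdec x)
    rw [map_sub, map_smul, hCn] at h1
    rw [form_comm n x, sub_smul, one_smul, smul_sub, ← add_sub_assoc, add_sub_right_comm,
      ← h1, sub_add_cancel]
  -- The normal is an eigenvector with eigenvalue `ε`, so this transvection has determinant `ε`.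
  have hCt : (C : Mink →ₗ[ℝ] Mink) = LinearMap.transvection (formₗ n) ((ε - 1) • n) :=
    LinearMap.ext hCx
  have hd : LinearMap.det (C : Mink →ₗ[ℝ] Mink) = 1 := by
    rw [← LinearEquiv.coe_det, hdet, Units.val_one]
  rw [hCt, LinearMap.transvection.det, formₗ_apply, form_smul_right, hn] at hd
  have hε1 : ε - 1 = 0 := by linarith
  refine LinearEquiv.ext fun x => ?_
  rw [hCx, hε1, zero_smul, smul_zero, add_zero]
  rfl

/-- Groups with the same marked length spectrum are conjugate by a linear isometry. -/
theorem exists_equivariant (hM : M.Nonelementary) (hN : N.Nonelementary)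
    (hg : 0 < translationLength g.1) (hg' : translationLength (φ g).1 = translationLength g.1)
    (h : IsAxis g.1 a r) (h' : IsAxis (φ g).1 a' r')
    (hform : ∀ γ : M.deck, form ((φ γ).1.1 a') r' = form (γ.1.1 a) r) :
    ∃ E : Mink ≃ₗ[ℝ] Mink, (∀ γ : M.deck, ∀ x, E (γ.1.1 x) = (φ γ).1.1 (E x)) ∧
      (∀ x y, form (E x) (E y) = form x y) ∧ FutureNull (E a) := by
  obtain ⟨F, hFe, hFf, hFa⟩ := exists_equivariant_on_span hM hN hg hg' h h' hform
  by_cases htop : M.orbitSpan a = ⊤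
  · have hmem : ∀ x, x ∈ M.orbitSpan a := fun x => htop ▸ Submodule.mem_top
    exact ⟨LinearEquiv.ofInjectiveEndo F
      (injective_of_form_eq fun x y => hFf x (hmem x) y (hmem y)), fun γ x => hFe γ x (hmem x),
      fun x y => hFf x (hmem x) y (hmem y), hFa⟩
  obtain ⟨y, hyV, hy⟩ := exists_timelike h.attracting.null h.repelling.null h.form_eq
    (Manifold.self_mem_orbitSpan (M := M)) (hM.repelling_mem h hg)
  obtain ⟨n, hn, hnV⟩ := exists_unit_normal htop hyV hy
  have h3 := three_le_finrank_orbitSpan hM hg h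
  have hle3 : ∀ W : Submodule ℝ Mink, W ≠ ⊤ → Module.finrank ℝ W ≤ 3 := fun W hW => by
    have := Submodule.finrank_lt hW
    rw [Module.finrank_fin_fun] at this
    omega
  have hmem : ∀ x, form x n = 0 → x ∈ M.orbitSpan a := by
    have hle : M.orbitSpan a ≤ LinearMap.ker (formₗ n) := fun v hv => by
      rw [LinearMap.mem_ker, formₗ_apply, form_comm, hnV v hv]
    have hker : LinearMap.ker (formₗ n) ≠ ⊤ := fun hk => by
      have : n ∈ LinearMap.ker (formₗ n) := hk ▸ Submodule.mem_top
      rw [LinearMap.mem_ker, formₗ_apply, hn] at this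
      norm_num at this
    have := Submodule.eq_of_le_of_finrank_le hle ((hle3 _ hker).trans h3)
    intro x hx
    rw [this, LinearMap.mem_ker, formₗ_apply, form_comm, hx]
  have hmap : (M.orbitSpan a).map F ≠ ⊤ := fun hm => by
    have h1 := Submodule.finrank_map_le F (M.orbitSpan a)
    rw [hm, finrank_top, Module.finrank_fin_fun] at h1
    have := hle3 _ htop
    omega
  obtain ⟨n', hn', hnV'⟩ := exists_unit_normal hmap (Submodule.mem_map_of_mem hyV)
    ((hFf y hyV y hyV).trans hy)
  have hp : ∀ x, x - form x n • n ∈ M.orbitSpan a := fun x => hmem _ (by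
    rw [form_sub_left, form_smul_left, hn]; ring)
  -- The extension sends the unit normal `n` to `n'`. Replacing `n'` by `-n'` would serve equally
  -- well, so the orientation of the conjugating map is not determined.
  set G : Mink →ₗ[ℝ] Mink := F.comp (LinearMap.id - (formₗ n).smulRight n) +
    (formₗ n).smulRight n' with hG
  have hGx : ∀ x, G x = F (x - form x n • n) + form x n • n' := fun x => by
    rw [form_comm]; rfl
  have hGV : ∀ x ∈ M.orbitSpan a, G x = F x := fun x hx => by
    rw [hGx, hnV x hx, zero_smul, zero_smul, sub_zero, add_zero]
  have hGf : ∀ x y, form (G x) (G y) = form x y := fun x y => by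
    have h1 := hnV' _ (Submodule.mem_map_of_mem (f := F) (hp x))
    have h2 := hnV' _ (Submodule.mem_map_of_mem (f := F) (hp y))
    rw [hGx, hGx]
    simp only [form_add_left, form_add_right, form_smul_left, form_smul_right, hn', h1,
      form_comm n', h2, hFf _ (hp x) _ (hp y), form_sub_left, form_sub_right, hn]
    rw [form_comm n y]
    ring
  set E := LinearEquiv.ofInjectiveEndo G (injective_of_form_eq hGf) with hE
  have hEG : ∀ x, E x = G x := fun x => rfl
  have hEf : ∀ x y, form (E x) (E y) = form x y := hGf
  have hEsf : ∀ x y, form (E.symm x) (E.symm y) = form x y := fun x y => by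
    rw [← hEf, E.apply_symm_apply, E.apply_symm_apply]
  refine ⟨E, fun γ x => ?_, hEf, by rwa [hEG, hGV a Manifold.self_mem_orbitSpan]⟩
  -- The defect of equivariance: it fixes the hyperplane pointwise and has determinant one because
  -- both deck groups preserve orientation.
  set C : Mink ≃ₗ[ℝ] Mink := γ.1.1⁻¹ * ((E.trans (φ γ).1.1).trans E.symm) with hC
  have hC1 : C = 1 := by
    refine eq_one_of_fixes_hyperplane (fun x y => ?_) ?_ hn fun x hx => ?_
    · change form (γ.1⁻¹.1 (E.symm ((φ γ).1.1 (E x)))) (γ.1⁻¹.1 (E.symm ((φ γ).1.1 (E y)))) = _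
      rw [SO31.form_apply, hEsf, SO31.form_apply, hEf]
    · have h1 : LinearEquiv.det ((E.trans (φ γ).1.1).trans E.symm) =
          LinearEquiv.det (φ γ).1.1 := LinearEquiv.det_conj (φ γ).1.1 E.symm
      rw [hC, map_mul, map_inv, h1, γ.1.2.2.2, (φ γ).1.2.2.2, inv_one, one_mul]
    · change γ.1⁻¹.1 (E.symm ((φ γ).1.1 (E x))) = x
      have hx' := hmem x hx
      rw [hEG, hGV x hx', ← hFe γ x hx', ← hGV _ (Manifold.apply_mem_of_mem_orbitSpan γ hx'),
        ← hEG, E.symm_apply_apply, SO31.inv_apply]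
  have h1 : γ.1⁻¹.1 (E.symm ((φ γ).1.1 (E x))) = x := LinearEquiv.congr_fun hC1 x
  rw [← h1, SO31.apply_inv, E.apply_symm_apply, h1]

/-! ### Descent of the conjugating map to the quotients -/

/-- A linear isometry preserves or exchanges the two sheets; one future null vector with future
image decides which. -/
theorem apply_three_pos {E : Mink ≃ₗ[ℝ] Mink} (hE : ∀ x y, form (E x) (E y) = form x y)
    (ha : FutureNull a) (hEa : FutureNull (E a)) (x : H3) : 0 < E x.1 3 := by
  have hn : form (E x.1) (E x.1) = -1 := by rw [hE, x.2.1]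
  have h1 : form (E x.1) (E a) < 0 := by rw [hE]; exact ha.form_neg x
  by_contra! hle
  rcases hle.lt_or_eq with h | h
  · have := hEa.form_neg ⟨-E x.1, by rw [form_neg_neg, hn], by rw [Pi.neg_apply]; linarith⟩
    rw [form_neg_left] at this
    linarith
  · simp only [form, h] at hn
    nlinarith [mul_self_nonneg (E x.1 0), mul_self_nonneg (E x.1 1), mul_self_nonneg (E x.1 2)]

/-- An equivariant linear isometry induces an isometry of the quotients. -/
theorem nonempty_isometryEquiv {E : Mink ≃ₗ[ℝ] Mink} (hE : ∀ x y, form (E x) (E y) = form x y)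
    (hφ : ∀ γ : M.deck, ∀ x, E (γ.1.1 x) = (φ γ).1.1 (E x)) (ha : FutureNull a)
    (hEa : FutureNull (E a)) : Nonempty (M.Carrier ≃ᵢ N.Carrier) := by
  have hEs : ∀ x y, form (E.symm x) (E.symm y) = form x y := fun x y => by
    rw [← hE, E.apply_symm_apply, E.apply_symm_apply]
  let e : H3 ≃ H3 :=
    { toFun := fun x => ⟨E x.1, by rw [hE, x.2.1], apply_three_pos hE ha hEa x⟩
      invFun := fun x => ⟨E.symm x.1, by rw [hEs, x.2.1],
        apply_three_pos hEs hEa (by rwa [E.symm_apply_apply]) x⟩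
      left_inv := fun x => Subtype.ext (E.symm_apply_apply _)
      right_inv := fun x => Subtype.ext (E.apply_symm_apply _) }
  have hdist : ∀ x y, dist (e x) (e y) = dist x y := fun x y => by
    rw [H3.dist_def, H3.dist_def]
    exact congrArg (fun t => Real.arcosh (-t)) (hE x.1 y.1)
  have heq : ∀ (γ : M.deck) (x : H3), e (γ • x) = φ γ • e x := fun γ x =>
    Subtype.ext (hφ γ x.1)
  let q : M.Carrier ≃ N.Carrier := Quotient.congr e fun x y => by
    rw [MulAction.orbitRel_apply, MulAction.orbitRel_apply]
    constructor
    · rintro ⟨γ, rfl⟩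
      exact ⟨φ γ, (heq γ y).symm⟩
    · rintro ⟨δ, hδ⟩
      obtain ⟨γ, rfl⟩ := φ.surjective δ
      exact ⟨γ, e.injective ((heq γ y).trans hδ)⟩
  refine ⟨⟨q, Isometry.of_dist_eq ?_⟩⟩
  rintro ⟨x⟩ ⟨y⟩
  change dist (N.proj (e x)) (N.proj (e y)) = dist (M.proj x) (M.proj y)
  rw [Manifold.dist_proj, Manifold.dist_proj]
  refine (φ.toEquiv.iInf_congr fun γ => ?_).symm
  change dist (e x) (φ γ • e y) = _
  rw [← heq, hdist]

end Conjugation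

end

end Hyp3

theorem mainTheorem3 (M N : Hyp3.Manifold)
    (hM : M.Nonelementary) (hN : N.Nonelementary)
    (h : Hyp3.Manifold.SameMarkedLengthSpectrum M N) :
    Nonempty (M.Carrier ≃ᵢ N.Carrier) := by
  obtain ⟨φ, hφ⟩ := h
  obtain ⟨g, hg⟩ := hM.exists_translationLength_pos
  have hg' : Hyp3.translationLength (φ g).1 = Hyp3.translationLength g.1 := hφ g
  obtain ⟨a, r, har⟩ := Hyp3.exists_isAxis hg
  obtain ⟨a', r', har'⟩ := Hyp3.exists_isAxis (hg'.symm ▸ hg)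
  have hl : ∀ (γ : M.deck) (n : ℕ), Hyp3.translationLength (g.1 ^ n * γ.1) =
      Hyp3.translationLength ((φ g).1 ^ n * (φ γ).1) := fun γ n => by
    have := hφ (g ^ n * γ)
    rw [map_mul, map_pow] at this
    exact this.symm
  have hform : ∀ γ : M.deck, Hyp3.form ((φ γ).1.1 a') r' = Hyp3.form (γ.1.1 a) r := fun γ => by
    -- Equal lengths allow the comparison in both directions, which gives equality of the pairings.
    have h1 := har.neg_form_le har' hg hg' fun n => (hl γ n).le
    have h2 := har'.neg_form_le har (hg'.symm ▸ hg) hg'.symm fun n => (hl γ n).ge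
    linarith
  obtain ⟨E, hE, hEf, hEa⟩ := Hyp3.exists_equivariant hM hN hg hg' har har' hform
  exact Hyp3.nonempty_isometryEquiv hEf hE har.attracting hEa
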